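/- Let $X$ be a Gromov hyperbolic metric space, i.e. for some $\delta\ge 0$ one has $(x|z)_o\ge\min\{(x|y)_o,(y|z)_o\}-\delta$ for all $o,x,y,z\in X$, where $(x|y)_o=\frac12(|ox|+|oy|-|xy|)$. A sequence $(x_i)$ in $X$ converges to infinity if $(x_i|x_j)_o\to\infty$ as $i,j\to\infty$; two such sequences are equivalent if $(x_i|x_i')_o\to\infty$, and $\partial_\infty X$ is the set of equivalence classes. For $\xi,\xi'\in\partial_\infty X$ and $y\in X$ put $(\xi|\xi')_o=\inf\liminf_i(x_i|x_i')_o\in[0,\infty]$ and $(y|\xi)_o=\inf\liminf_i(y|x_i)_o$, the infima over all $(x_i)\in\xi$, $(x_i')\in\xi'$. Assume that $X$ is visual: there are $o\in X$ and $D>0$ such that for every $y\in X$ there is $\xi\in\partial_\infty X$ with $|oy|\le(y|\xi)_o+D$. Let $d$ be any visual metric on $\partial_\infty X$, i.e. a metric for which there are $o\in X$, $a>1$ and $c_1,c_2>0$ with $c_1a^{-(\xi|\xi')_o}\le d(\xi,\xi')\le c_2a^{-(\xi|\xi')_o}$ for all $\xi,\xi'\in\partial_\infty X$ (where $a^{-\infty}=0$),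 and assume that $(\partial_\infty X,d)$ is doubling: for some $C$, every ball of radius $r>0$ can be covered by at most $C$ balls of radius $r/2$. Then the capacity dimension $n$ of $(\partial_\infty X,d)$ is finite, and $X$ admits a quasi-isometric embedding into the product of $n+1$ copies of the binary metric tree, that is, a map $f$ such that for some $a_1,a_2>0$, $b\ge0$ one has $a_1|xx'|-b\le|f(x)f(x')|\le a_2|xx'|+b$ for all $x,x'\in X$. Here the binary metric tree is the simplicial metric tree with all edges of length $1$ and all vertices of valence $3$, the product carries the maximum metric (the $\ell_1$ or $\ell_2$ product metric gives an equivalent statement), and the capacity dimension of a metric space $Z$ is the minimal integer $m\ge0$ for which there is $\delta>0$ such that for every sufficiently small $\tau>0$ there is an open covering $\mathcal U$ of $Z$ which is the union of $m+1$ families, each consisting of pairwise disjoint sets, with $\operatorname{diam}U\le\tau$ for all $U\in\mathcal U$ and Lebesgue number $\inf_{z\in Z}\sup_{U\in\mathcal U}\operatorname{dist}(z,Z\setminus U)\ge\delta\tau$ (where $\operatorname{dist}(z,\emptyset)=\infty$). -/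

import Mathlib

open Filter Topology

noncomputable section

/-! ### Hyperbolic spaces -/

/-- The Gromov product `(x|y)_o`. -/
def gromovProd {X : Type*} [MetricSpace X] (o x y : X) : ℝ :=
  (dist o x + dist o y - dist x y) / 2

/-- `(a, b, c)` is a `δ`-triple: each entry is at least the minimum of the other two minus `δ`. -/
def IsDeltaTriple (δ a b c : ℝ) : Prop :=
  min b c - δ ≤ a ∧ min c a - δ ≤ b ∧ min a b - δ ≤ c

/-- Gromov hyperbolic metric spaces. -/
class GromovHyperbolic (X : Type*) [MetricSpace X] : Prop where
  exists_delta : ∃ δ : ℝ, 0 ≤ δ ∧ ∀ o x y z : X,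
    IsDeltaTriple δ (gromovProd o x y) (gromovProd o y z) (gromovProd o x z)

/-! ### The boundary at infinity -/

/-- The sequence `x` converges to infinity: `(x_i|x_j)_o → ∞` as `i, j → ∞`. The condition does
not depend on the base point, see `tendsto_gromovProd_of_base`. -/
def ConvergesToInfinity {X : Type*} [MetricSpace X] (x : ℕ → X) : Prop :=
  ∀ o : X, Tendsto (fun p : ℕ × ℕ => gromovProd o (x p.1) (x p.2)) atTop atTop

theorem gromovProd_base {X : Type*} [MetricSpace X] (o o' x y : X) :
    gromovProd o x y - dist o o' ≤ gromovProd o' x y := by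
  unfold gromovProd
  have h1 := dist_triangle o o' x
  have h2 := dist_triangle o o' y
  linarith

theorem tendsto_gromovProd_of_base {X ι : Type*} [MetricSpace X] {l : Filter ι} {x y : ι → X}
    (o o' : X) (h : Tendsto (fun i => gromovProd o (x i) (y i)) l atTop) :
    Tendsto (fun i => gromovProd o' (x i) (y i)) l atTop :=
  tendsto_atTop_mono (fun i => gromovProd_base o o' (x i) (y i))
    (tendsto_atTop_add_const_right l (-dist o o') h)

/-- Sequences converging to infinity, where `x` and `y` are equivalent if `(x_i|y_i)_o → ∞`. -/
def boundarySetoid (X : Type*) [MetricSpace X] [GromovHyperbolic X] :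
    Setoid {x : ℕ → X // ConvergesToInfinity x} where
  r x y := ∀ o : X, Tendsto (fun i => gromovProd o (x.1 i) (y.1 i)) atTop atTop
  iseqv :=
    { refl := fun x o => (x.2 o).comp tendsto_atTop_diagonal
      symm := by
        intro x y h o
        refine (h o).congr fun i => ?_
        simp only [gromovProd, dist_comm (x.1 i) (y.1 i)]
        ring
      trans := by
        intro x y z hxy hyz o
        obtain ⟨δ, -, hδ⟩ := GromovHyperbolic.exists_delta (X := X)
        refine tendsto_atTop_mono (fun i => (hδ o (x.1 i) (y.1 i) (z.1 i)).2.2) ?_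
        refine tendsto_atTop_add_const_right _ (-δ) ?_
        rw [tendsto_atTop]
        intro b
        filter_upwards [tendsto_atTop.1 (hxy o) b, tendsto_atTop.1 (hyz o) b] with i h1 h2
        exact le_min h1 h2 }

/-- The boundary at infinity of a hyperbolic space. -/
def GromovBoundary (X : Type*) [MetricSpace X] [GromovHyperbolic X] : Type _ :=
  Quotient (boundarySetoid X)

/-- The sequence `x` belongs to the class `ξ`. -/
def GromovBoundary.Mem {X : Type*} [MetricSpace X] [GromovHyperbolic X]
    (ξ : GromovBoundary X) (x : ℕ → X) : Prop :=
  ∃ h : ConvergesToInfinity x, Quotient.mk (boundarySetoid X) ⟨x, h⟩ = ξ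

/-- `(ξ|ξ')_o = inf liminf (x_i|x'_i)_o`, the infimum over all `x ∈ ξ` and `x' ∈ ξ'`. -/
def boundaryProd {X : Type*} [MetricSpace X] [GromovHyperbolic X] (o : X)
    (ξ ξ' : GromovBoundary X) : EReal :=
  ⨅ (x : ℕ → X) (_ : ξ.Mem x) (x' : ℕ → X) (_ : ξ'.Mem x'),
    liminf (fun i => (gromovProd o (x i) (x' i) : EReal)) atTop

/-- `(y|ξ)_o = inf liminf (y|x_i)_o`, the infimum over all `x ∈ ξ`, for a point `y` of the space. -/
def pointBoundaryProd {X : Type*} [MetricSpace X] [GromovHyperbolic X] (o y : X)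
    (ξ : GromovBoundary X) : EReal :=
  ⨅ (x : ℕ → X) (_ : ξ.Mem x), liminf (fun i => (gromovProd o y (x i) : EReal)) atTop

/-- Visual hyperbolic spaces. -/
def IsVisualSpace (X : Type*) [MetricSpace X] [GromovHyperbolic X] : Prop :=
  ∃ (o : X) (D : ℝ), 0 < D ∧ ∀ y : X, ∃ ξ : GromovBoundary X,
    ((dist o y : ℝ) : EReal) ≤ pointBoundaryProd o y ξ + (D : EReal)

/-- `a ^ (-t)` for `t ∈ [0, ∞]`, with `a ^ (-∞) = 0`. -/
def powNeg (a : ℝ) (t : EReal) : ℝ :=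
  if t = ⊤ then 0 else a ^ (-t.toReal)

/-- The given metric on the boundary at infinity of `X` is visual, with respect to some base
point `o` and some parameter `a > 1`. -/
def IsVisualMetric (X : Type*) [MetricSpace X] [GromovHyperbolic X]
    [MetricSpace (GromovBoundary X)] : Prop :=
  ∃ (o : X) (a c₁ c₂ : ℝ), 1 < a ∧ 0 < c₁ ∧ 0 < c₂ ∧ ∀ ξ ξ' : GromovBoundary X,
    c₁ * powNeg a (boundaryProd o ξ ξ') ≤ dist ξ ξ' ∧
      dist ξ ξ' ≤ c₂ * powNeg a (boundaryProd o ξ ξ')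

/-! ### Doubling spaces and capacity dimension -/

/-- Doubling: every ball of radius `r` is covered by at most `C` balls of radius `r / 2`. -/
def IsDoublingSpace (Z : Type*) [MetricSpace Z] : Prop :=
  ∃ C : ℕ, 1 ≤ C ∧ ∀ (z : Z) (r : ℝ), 0 < r →
    ∃ S : Finset Z, S.card ≤ C ∧ Metric.ball z r ⊆ ⋃ s ∈ S, Metric.ball s (r / 2)

/-- The supremum of the diameters of the members of a family of sets. -/
def mesh {Z : Type*} [MetricSpace Z] (𝒰 : Set (Set Z)) : ENNReal :=
  ⨆ U ∈ 𝒰, Metric.ediam U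

/-- The Lebesgue number of a covering, `inf_z sup_U dist (z, Z \ U)`, where the distance to the
empty set is `∞`. It is not cut off at the mesh, which is `0` for fine coverings of a space such as
a pair of points; the capacity dimension of a point or of a finite set is `0`. -/
def lebesgueNumber {Z : Type*} [MetricSpace Z] (𝒰 : Set (Set Z)) : ENNReal :=
  ⨅ z : Z, ⨆ U ∈ 𝒰, Metric.infEDist z Uᶜ

/-- The union of the families `𝒰 c`, `c` in the set of `k` colors, is a `k`-colored open covering:
each family is disjoint, its members are open, and all members together cover the space. -/
structure IsColoredOpenCovering {Z : Type*} [MetricSpace Z] {k : ℕ}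
    (𝒰 : Fin k → Set (Set Z)) : Prop where
  isOpen : ∀ c, ∀ U ∈ 𝒰 c, IsOpen U
  disjoint : ∀ c, (𝒰 c).PairwiseDisjoint id
  covers : ⋃₀ (⋃ c, 𝒰 c) = Set.univ

/-- The defining property of `cdim Z ≤ m`. -/
def CapacityDimProperty (Z : Type*) [MetricSpace Z] (m : ℕ) : Prop :=
  ∃ δ : ℝ, 0 < δ ∧ ∃ τ₀ : ℝ, 0 < τ₀ ∧ ∀ τ : ℝ, 0 < τ → τ < τ₀ →
    ∃ 𝒰 : Fin (m + 1) → Set (Set Z), IsColoredOpenCovering 𝒰 ∧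
      mesh (⋃ c, 𝒰 c) ≤ ENNReal.ofReal τ ∧
      ENNReal.ofReal (δ * τ) ≤ lebesgueNumber (⋃ c, 𝒰 c)

/-- The capacity dimension: the minimal `m` with the property above, `∞` if there is none. -/
def capacityDim (Z : Type*) [MetricSpace Z] : ℕ∞ :=
  ⨅ (m : ℕ) (_ : CapacityDimProperty Z m), (m : ℕ∞)

/-! ### The binary metric tree -/

/-- The vertices of the binary tree are the words over `Fin 3` without two equal adjacent letters;
`a :: w` is joined to `w`, so that the empty word has the three neighbours `[a]`, and `b :: w` has
the neighbours `w` and `a :: b :: w` for the two letters `a ≠ b`. The edge from `w` to `a :: w` is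
labelled by `a :: w`. The vertex `w` is placed in the space `ℓ¹` over the labels at the sum of the
unit vectors of the edges on the path from the root to `w`. -/
def treeVertex : List (Fin 3) → lp (fun _ : List (Fin 3) => ℝ) 1
  | [] => 0
  | a :: w => treeVertex w + lp.single 1 (a :: w) (1 : ℝ)

/-- The binary metric tree: the union of the unit segments which realize the edges. The distance
in `ℓ¹` of two of its points is the length of the arc of the tree between them, since this arc is
the symmetric difference of the arcs from the root. -/
def BinaryMetricTree : Type :=
  {x : lp (fun _ : List (Fin 3) => ℝ) 1 // ∃ (a : Fin 3) (w : List (Fin 3)),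
    (a :: w).IsChain (· ≠ ·) ∧ x ∈ segment ℝ (treeVertex w) (treeVertex (a :: w))}

instance instMetricSpaceBinaryMetricTree : MetricSpace BinaryMetricTree :=
  inferInstanceAs (MetricSpace {x : lp (fun _ : List (Fin 3) => ℝ) 1 //
    ∃ (a : Fin 3) (w : List (Fin 3)),
      (a :: w).IsChain (· ≠ ·) ∧ x ∈ segment ℝ (treeVertex w) (treeVertex (a :: w))})

/-! ### Quasi-isometric embeddings -/

def IsQuasiIsometricEmbedding {X Y : Type*} [MetricSpace X] [MetricSpace Y] (f : X → Y) : Prop :=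
  ∃ a₁ a₂ b : ℝ, 0 < a₁ ∧ 0 < a₂ ∧ 0 ≤ b ∧ ∀ x x' : X,
    a₁ * dist x x' - b ≤ dist (f x) (f x') ∧ dist (f x) (f x') ≤ a₂ * dist x x' + b

end


/-!
The space `X` is compared with the hyperbolic cone over its boundary `Z`: the point `y` corresponds
to `(ξ y, k)`, where `ξ y` is a shadow of `y` on the boundary and `k` is proportional to `|oy|`.
A sequence of `(n + 1)`-colored coverings of `Z` at the scales `κ r ^ i` is modified so that the
sets of each color, the rooms, are nested. A point of the cone then has, for each color, a list of
rooms around it, one tree of rooms per color, and the distance in the cone is comparable to the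
largest distance in these trees.

The trees of rooms have infinite valence even if `Z` is doubling, since a room of level `i` has
children on all levels `j > i`, and so they do not embed into the binary tree. But rooms of
comparable size can be told apart locally by finitely many colors. Each node of a tree carries a
diary: a word that holds, in pages of at most `Λ` letters, the colors of the rooms at the levels
passed so far. A jump over many levels takes many pages to write down, and the diary is behind
until there have been enough further rooms; the total number of levels bounds how far behind it can
be, and this costs only a constant factor in the distance. The words over the finite alphabet of
pages embed into the binary tree.
-/

/-! ### Coverings -/

section Coverings

variable {Z : Type*} [MetricSpace Z] {𝒰 : Set (Set Z)} {ε : ℝ}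

theorem ofReal_le_lebesgueNumber (h : ∀ z, ∃ U ∈ 𝒰, Metric.ball z ε ⊆ U) :
    ENNReal.ofReal ε ≤ lebesgueNumber 𝒰 := by
  refine le_iInf fun z => ?_
  obtain ⟨U, hU, hzU⟩ := h z
  refine le_iSup₂_of_le U hU (Metric.le_infEDist.2 fun w hw => ?_)
  rw [edist_dist]
  refine ENNReal.ofReal_le_ofReal (not_lt.1 fun hlt => hw (hzU ?_))
  rwa [Metric.mem_ball, dist_comm]

theorem exists_ball_subset_of_ofReal_le_lebesgueNumber (h : ENNReal.ofReal ε ≤ lebesgueNumber 𝒰)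
    {r : ℝ} (hε : 0 < ε) (hr : r < ε) (z : Z) : ∃ U ∈ 𝒰, Metric.ball z r ⊆ U := by
  have hlt : ENNReal.ofReal r < ⨆ U ∈ 𝒰, Metric.infEDist z Uᶜ :=
    ((ENNReal.ofReal_lt_ofReal_iff hε).2 hr).trans_le (h.trans (iInf_le _ z))
  obtain ⟨U, hU, hzU⟩ := by simpa only [lt_iSup_iff, exists_prop] using hlt
  refine ⟨U, hU, fun w hw => by_contra fun hwU => ?_⟩
  have := hzU.trans_le (Metric.infEDist_le_edist_of_mem hwU)
  rw [edist_dist, dist_comm] at this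
  exact (ENNReal.ofReal_lt_ofReal_iff'.1 this).1.not_gt hw

theorem dist_le_of_mesh_le (hε : 0 ≤ ε) (h : mesh 𝒰 ≤ ENNReal.ofReal ε) {U : Set Z} (hU : U ∈ 𝒰)
    {x y : Z} (hx : x ∈ U) (hy : y ∈ U) : dist x y ≤ ε := by
  rw [← ENNReal.ofReal_le_ofReal_iff hε, ← edist_dist]
  exact (Metric.edist_le_ediam_of_mem hx hy).trans ((le_iSup₂ U hU).trans h)

end Coverings

/-! ### Doubling spaces -/

/-- A greedy coloring along a well-ordering of the vertices. -/
theorem colorable_of_encard_neighborSet_le {V : Type*} (G : SimpleGraph V) {Q : ℕ}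
    (h : ∀ v, (G.neighborSet v).encard ≤ Q) : G.Colorable (Q + 1) := by
  classical
  have exists_free (v : V) (χ : V → Fin (Q + 1)) : ∃ c, c ∉ χ '' G.neighborSet v := by
    by_contra! hall
    have := (Set.encard_image_le χ _).trans (h v)
    rw [Set.eq_univ_of_forall hall, Set.encard_univ, ENat.card_eq_coe_fintype_card,
      Fintype.card_fin] at this
    exact absurd (Nat.cast_le.1 this) (by omega)
  choose free hfree using exists_free
  have wf : WellFounded (WellOrderingRel : V → V → Prop) := IsWellFounded.wf
  let χ : V → Fin (Q + 1) := wf.fix fun v ih =>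
    free v fun w => if hw : WellOrderingRel w v then ih w hw else 0
  have hχ (v : V) : χ v = free v fun w => if WellOrderingRel w v then χ w else 0 := wf.fix_eq _ v
  have ne_of_rel {v w : V} (hadj : G.Adj v w) (hwv : WellOrderingRel w v) : χ v ≠ χ w :=
    fun heq => hfree v (fun w => if WellOrderingRel w v then χ w else 0)
      ⟨w, hadj, by rw [← hχ v, heq]; exact if_pos hwv⟩
  refine ⟨SimpleGraph.Coloring.mk χ fun {v w} hadj => ?_⟩
  rcases trichotomous_of WellOrderingRel v w with hlt | rfl | hgt
  · exact (ne_of_rel hadj.symm hlt).symm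
  · exact absurd hadj G.irrefl
  · exact ne_of_rel hadj hgt

namespace IsDoublingSpace

variable {Z : Type*} [MetricSpace Z]

theorem exists_finset_cover_ball (h : IsDoublingSpace Z) (m : ℕ) : ∃ Q : ℕ, ∀ (z : Z) (r : ℝ),
    0 < r → ∃ S : Finset Z, S.card ≤ Q ∧ Metric.ball z r ⊆ ⋃ s ∈ S, Metric.ball s (r / 2 ^ m) := by
  classical
  obtain ⟨C, -, hC⟩ := h
  induction m with
  | zero => exact ⟨1, fun z r _ => ⟨{z}, by simp, by simp⟩⟩
  | succ m ih =>
    obtain ⟨Q, hQ⟩ := ih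
    refine ⟨Q * C, fun z r hr => ?_⟩
    obtain ⟨S, hS, hScov⟩ := hQ z r hr
    choose T hT hTcov using fun s : Z => hC s (r / 2 ^ m) (by positivity)
    refine ⟨S.biUnion T, (Finset.card_biUnion_le_card_mul _ _ _ fun s _ => hT s).trans
      (Nat.mul_le_mul_right _ hS), hScov.trans (Set.iUnion₂_subset fun s hs => ?_)⟩
    rw [pow_succ, ← div_div]
    exact (hTcov s).trans (Set.biUnion_mono (Finset.subset_biUnion_of_mem T hs) fun _ _ => le_rfl)

theorem exists_encard_le_of_separated (h : IsDoublingSpace Z) (M : ℝ) : ∃ Q : ℕ, ∀ ε : ℝ, 0 < ε →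
    ∀ (P : Set Z) (z : Z), (P.Pairwise fun x y => ε ≤ dist x y) → P ⊆ Metric.ball z (M * ε) →
      P.encard ≤ Q := by
  obtain ⟨m, hm⟩ := pow_unbounded_of_one_lt (2 * M) (one_lt_two (α := ℝ))
  obtain ⟨Q, hQ⟩ := h.exists_finset_cover_ball m
  refine ⟨Q, fun ε hε P z hsep hP => ?_⟩
  rcases le_or_gt (M * ε) 0 with hM | hM
  · rw [Metric.ball_eq_empty.2 hM, Set.subset_empty_iff] at hP
    simp [hP]
  obtain ⟨S, hS, hcov⟩ := hQ z (M * ε) hM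
  have hsmall : M * ε / 2 ^ m < ε / 2 := by
    rw [div_lt_div_iff₀ (by positivity) two_pos]
    nlinarith
  have hnear (x : Z) (hx : x ∈ P) : ∃ s ∈ S, dist x s < ε / 2 := by
    obtain ⟨s, hs, hxs⟩ := Set.mem_iUnion₂.1 (hcov (hP hx))
    exact ⟨s, hs, hxs.out.trans hsmall⟩
  choose! p hpS hp using hnear
  have hinj : P.InjOn p := fun x hx y hy hxy => by_contra fun hne => by
    have hpy := hp y hy
    rw [← hxy] at hpy
    linarith [hsep hx hy hne, hp x hx, dist_triangle_right x y (p x)]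
  calc P.encard ≤ (S : Set Z).encard := Set.encard_le_encard_of_injOn hpS hinj
    _ ≤ Q := by rw [Set.encard_coe_eq_coe_finsetCard]; exact_mod_cast hS

end IsDoublingSpace

theorem exists_separated_net (Z : Type*) [MetricSpace Z] {ε : ℝ} (hε : 0 < ε) :
    ∃ P : Set Z, (P.Pairwise fun x y => ε ≤ dist x y) ∧ ∀ z, ∃ p ∈ P, dist z p < ε := by
  obtain ⟨P, hP⟩ := zorn_subset {P : Set Z | P.Pairwise fun x y => ε ≤ dist x y}
    fun c hc hchain => ⟨⋃₀ c, (Set.pairwise_sUnion hchain.directedOn).2 hc,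
      fun s hs => Set.subset_sUnion_of_mem hs⟩
  refine ⟨P, hP.prop, fun z => ?_⟩
  by_contra! hfar
  have hinsert : insert z P ⊆ P := hP.2 (hP.prop.insert fun p hp _ =>
    ⟨hfar p hp, (hfar p hp).trans_eq (dist_comm z p)⟩) (Set.subset_insert z P)
  exact (hfar z (hinsert (Set.mem_insert z P))).not_gt (by rwa [dist_self])

namespace IsDoublingSpace

variable {Z : Type*} [MetricSpace Z]

theorem exists_coloring (h : IsDoublingSpace Z) (A : ℝ) : ∃ Q : ℕ, ∀ τ : ℝ, 0 < τ →
    ∃ χ : Z → Fin (Q + 1), ∀ x y, χ x = χ y → dist x y ≤ A * τ → dist x y ≤ 2 * τ := by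
  obtain ⟨Q, hQ⟩ := h.exists_encard_le_of_separated (A + 2)
  refine ⟨Q, fun τ hτ => ?_⟩
  obtain ⟨P, hsep, hnet⟩ := exists_separated_net Z hτ
  choose p hpP hp using hnet
  let G : SimpleGraph P :=
    { Adj := fun x y => x ≠ y ∧ dist (x : Z) y < (A + 2) * τ
      symm := ⟨fun x y hxy => ⟨hxy.1.symm, by rw [dist_comm]; exact hxy.2⟩⟩
      loopless := ⟨fun x hx => hx.1 rfl⟩ }
  have hdeg (v : P) : (G.neighborSet v).encard ≤ Q := by
    rw [← Subtype.val_injective.encard_image]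
    refine hQ τ hτ _ v (hsep.mono (Subtype.coe_image_subset P _)) ?_
    rintro _ ⟨w, hw, rfl⟩
    exact Metric.mem_ball'.2 hw.2
  obtain ⟨χ⟩ := colorable_of_encard_neighborSet_le G hdeg
  refine ⟨fun z => χ ⟨p z, hpP z⟩, fun x y hxy hd => ?_⟩
  have hpxy : p x = p y := by
    by_contra hne
    refine χ.valid (v := ⟨p x, hpP x⟩) (w := ⟨p y, hpP y⟩) ⟨by simpa using hne, ?_⟩ hxy
    have := dist_triangle4_left x y (p x) (p y)
    linarith [dist_triangle4 (p x) x y (p y), dist_comm x (p x), hp x, hp y]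
  have hpy := hp y
  rw [← hpxy] at hpy
  linarith [dist_triangle_right x y (p x), hp x]

theorem exists_coloring_sets (h : IsDoublingSpace Z) (A : ℝ) : ∃ Q : ℕ, ∀ τ : ℝ, 0 < τ →
    ∃ χ : Set Z → Fin (Q + 1), ∀ V W : Set Z, χ V = χ W →
      (∀ x ∈ V, ∀ y ∈ V, dist x y ≤ 2 * τ) → (∀ x ∈ W, ∀ y ∈ W, dist x y ≤ 2 * τ) →
      ∀ x ∈ V, ∀ y ∈ W, dist x y ≤ A * τ → dist x y ≤ 6 * τ := by
  rcases isEmpty_or_nonempty Z with hZ | hZ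
  · exact ⟨0, fun τ _ => ⟨fun _ => 0, fun _ _ _ _ _ x => isEmptyElim x⟩⟩
  obtain ⟨Q, hQ⟩ := h.exists_coloring (A + 4)
  refine ⟨Q, fun τ hτ => ?_⟩
  obtain ⟨χ, hχ⟩ := hQ τ hτ
  let base (V : Set Z) : Z := Classical.epsilon (· ∈ V)
  have hbase {V : Set Z} {x : Z} (hx : x ∈ V) : base V ∈ V := Classical.epsilon_spec ⟨x, hx⟩
  refine ⟨fun V => χ (base V), fun V W hVW hV hW x hx y hy hxy => ?_⟩
  have hxV := hV x hx _ (hbase hx)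
  have hyW := hW y hy _ (hbase hy)
  have hclose : dist (base V) (base W) ≤ 2 * τ := by
    refine hχ _ _ hVW ?_
    linarith [dist_triangle4 (base V) x y (base W), dist_comm x (base V)]
  linarith [dist_triangle4 x (base V) (base W) y, dist_comm y (base W)]

end IsDoublingSpace

/-! ### Capacity dimension -/

section ColorClass

variable {Z κ : Type*} [MetricSpace Z] (χ : Z → κ) (t : ℝ)

/-- The points of the color of `z` close to `z`. It is a class of the relation of equal color and
small distance when `χ` separates the distances up to `5 t` of points of equal color. -/
def colorClass (z : Z) : Set Z := {w | χ w = χ z ∧ dist w z ≤ 2 * t}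

variable {χ t}

theorem dist_le_of_mem_colorClass (hχ : ∀ x y, χ x = χ y → dist x y ≤ 5 * t → dist x y ≤ 2 * t)
    {z x y : Z} (hx : x ∈ colorClass χ t z) (hy : y ∈ colorClass χ t z) : dist x y ≤ 2 * t := by
  have ht : 0 ≤ 2 * t := dist_nonneg.trans hx.2
  exact hχ x y (hx.1.trans hy.1.symm) (by linarith [dist_triangle_right x y z, hx.2, hy.2])

theorem colorClass_eq_of_dist_lt (hχ : ∀ x y, χ x = χ y → dist x y ≤ 5 * t → dist x y ≤ 2 * t)
    {z z' x x' : Z} (hc : χ z = χ z') (hx : x ∈ colorClass χ t z) (hx' : x' ∈ colorClass χ t z')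
    (hd : dist x x' < t) : colorClass χ t z = colorClass χ t z' := by
  have hxz' : dist x z' ≤ 2 * t := hχ x z' (hx.1.trans hc)
    (by linarith [dist_triangle x x' z', hx'.2, dist_nonneg (x := x) (y := x')])
  have hzz' : dist z z' ≤ 2 * t := hχ z z' hc
    (by linarith [dist_triangle_left z z' x, hx.2, dist_nonneg (x := x) (y := x')])
  have ht : 0 ≤ t := dist_nonneg.trans hd.le
  ext w
  constructor
  · rintro ⟨hw, hwz⟩
    exact ⟨hw.trans hc, hχ w z' (hw.trans hc) (by linarith [dist_triangle w z z'])⟩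
  · rintro ⟨hw, hwz⟩
    exact ⟨hw.trans hc.symm, hχ w z (hw.trans hc.symm)
      (by linarith [dist_triangle_right w z z'])⟩

end ColorClass

theorem IsDoublingSpace.exists_capacityDimProperty {Z : Type*} [MetricSpace Z]
    (h : IsDoublingSpace Z) : ∃ m, CapacityDimProperty Z m := by
  obtain ⟨Q, hQ⟩ := h.exists_coloring 5
  refine ⟨Q, 1 / 8, by norm_num, 1, one_pos, fun τ hτ _ => ?_⟩
  obtain ⟨χ, hχ⟩ := hQ (τ / 4) (by positivity)
  let V (z : Z) : Set Z := Metric.thickening (τ / 8) (colorClass χ (τ / 4) z)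
  have ball_subset (z : Z) : Metric.ball z (τ / 8) ⊆ V z :=
    Metric.ball_subset_thickening (E := colorClass χ (τ / 4) z)
      ⟨rfl, by rw [dist_self]; positivity⟩ _
  refine ⟨fun c => V '' {z | χ z = c}, ⟨?_, ?_, ?_⟩, ?_, ?_⟩
  · rintro c _ ⟨z, -, rfl⟩
    exact Metric.isOpen_thickening
  · rintro c _ ⟨z, hz, rfl⟩ _ ⟨z', hz', rfl⟩ hne
    refine Set.disjoint_left.2 fun w hw hw' => hne ?_
    obtain ⟨x, hx, hwx⟩ := Metric.mem_thickening_iff.1 hw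
    obtain ⟨x', hx', hwx'⟩ := Metric.mem_thickening_iff.1 hw'
    simp only [V]
    rw [colorClass_eq_of_dist_lt hχ (hz.trans hz'.symm) hx hx'
      (by linarith [dist_triangle_left x x' w])]
  · exact Set.eq_univ_of_forall fun z => ⟨V z, Set.mem_iUnion.2 ⟨χ z, z, rfl, rfl⟩,
      ball_subset z (Metric.mem_ball_self (by positivity))⟩
  · refine iSup₂_le fun U hU => ?_
    obtain ⟨c, z, -, rfl⟩ := Set.mem_iUnion.1 hU
    refine Metric.ediam_le fun x hx y hy => ?_
    obtain ⟨x', hx', hxx'⟩ := Metric.mem_thickening_iff.1 hx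
    obtain ⟨y', hy', hyy'⟩ := Metric.mem_thickening_iff.1 hy
    rw [edist_dist]
    refine ENNReal.ofReal_le_ofReal ?_
    linarith [dist_triangle4 x x' y' y, dist_comm y y', dist_le_of_mem_colorClass hχ hx' hy']
  · refine ofReal_le_lebesgueNumber fun z => ⟨V z, Set.mem_iUnion.2 ⟨χ z, z, rfl, rfl⟩, ?_⟩
    rw [one_div_mul_eq_div]
    exact ball_subset z

theorem exists_capacityDim_eq {Z : Type*} [MetricSpace Z] (h : ∃ m, CapacityDimProperty Z m) :
    ∃ n : ℕ, capacityDim Z = (n : ℕ∞) ∧ CapacityDimProperty Z n := by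
  classical
  exact ⟨Nat.find h, le_antisymm (iInf₂_le _ (Nat.find_spec h))
    (le_iInf₂ fun m hm => by exact_mod_cast Nat.find_min' h hm), Nat.find_spec h⟩

/-! ### Laminar families of rooms -/

section Rooms

variable {Z : Type*} [MetricSpace Z]

/-- For families `𝒞 j` of cores on the levels `j`, the points `x` and `y` are linked above the level
`i` if `x = y` or if they are joined by a chain of `ρ j`-neighbourhoods of cores of levels `j > i`
in which the coarsest level occurs only once. -/
inductive Linked (𝒞 : ℕ → Set (Set Z)) (ρ : ℕ → ℝ) : ℕ → Z → Z → Prop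
  | refl (i : ℕ) (x : Z) : Linked 𝒞 ρ i x x
  | through {i j : ℕ} {W : Set Z} {x x' y' y : Z} : i < j → W ∈ 𝒞 j → Linked 𝒞 ρ j x x' →
      x' ∈ Metric.thickening (ρ j) W → y' ∈ Metric.thickening (ρ j) W → Linked 𝒞 ρ j y' y →
      Linked 𝒞 ρ i x y

/-- The room of the core `U` of level `i`: the points linked to the core above the level `i`. -/
def room (𝒞 : ℕ → Set (Set Z)) (ρ : ℕ → ℝ) (i : ℕ) (U : Set Z) : Set Z :=
  {z | ∃ u ∈ U, Linked 𝒞 ρ i u z}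

theorem Linked.symm {𝒞 : ℕ → Set (Set Z)} {ρ : ℕ → ℝ} {i : ℕ} {x y : Z} (h : Linked 𝒞 ρ i x y) :
    Linked 𝒞 ρ i y x := by
  induction h with
  | refl i x => exact .refl i x
  | through hij hW _ hx' hy' _ ihx ihy => exact .through hij hW ihy hy' hx' ihx

/-- Cores of level `i` have diameter at most `σ i` and distinct ones are separated by `6 s σ i`;
the scales `σ i` decrease fast compared with `s`. -/
structure IsCoreSystem (𝒞 : ℕ → Set (Set Z)) (s : ℝ) (σ : ℕ → ℝ) : Prop where
  s_pos : 0 < s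
  s_le : s ≤ 1 / 4
  scale_pos : ∀ i, 0 < σ i
  scale_succ_le : ∀ i, σ (i + 1) ≤ s / 4 * σ i
  dist_le : ∀ i, ∀ U ∈ 𝒞 i, ∀ x ∈ U, ∀ y ∈ U, dist x y ≤ σ i
  eq_of_dist_lt : ∀ i, ∀ U ∈ 𝒞 i, ∀ W ∈ 𝒞 i, ∀ x ∈ U, ∀ y ∈ W, dist x y < 6 * s * σ i → U = W

/-- Families `𝒱 i` of rooms on the levels `i`: rooms of one level are disjoint, and a room that
meets a room of a finer level `j` contains its `μ j`-neighbourhood. -/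
structure IsLaminar (𝒱 : ℕ → Set (Set Z)) (μ : ℕ → ℝ) : Prop where
  margin_pos : ∀ i, 0 < μ i
  margin_anti : Antitone μ
  eq_of_mem : ∀ i, ∀ V ∈ 𝒱 i, ∀ W ∈ 𝒱 i, ∀ x ∈ V, x ∈ W → V = W
  mem_of_near : ∀ i j, i < j → ∀ V ∈ 𝒱 i, ∀ W ∈ 𝒱 j, ∀ x ∈ V, x ∈ W →
    ∀ y ∈ W, ∀ z, dist y z < μ j → z ∈ V

namespace IsCoreSystem

variable {𝒞 : ℕ → Set (Set Z)} {s : ℝ} {σ : ℕ → ℝ}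

theorem scale_anti (h : IsCoreSystem 𝒞 s σ) : Antitone σ :=
  antitone_nat_of_succ_le fun i => (h.scale_succ_le i).trans
    (mul_le_of_le_one_left (h.scale_pos i).le (by linarith [h.s_le]))

theorem scale_le_of_lt (h : IsCoreSystem 𝒞 s σ) {i j : ℕ} (hij : i < j) : σ j ≤ s / 4 * σ i :=
  (h.scale_anti hij).trans (h.scale_succ_le i)

theorem dist_le_of_linked (h : IsCoreSystem 𝒞 s σ) {i : ℕ} {x y : Z}
    (hxy : Linked 𝒞 (fun j => 2 * s * σ j) i x y) : dist x y ≤ s * σ i := by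
  have hs := h.s_pos
  induction hxy with
  | refl i x =>
    rw [dist_self]
    exact mul_nonneg hs.le (h.scale_pos i).le
  | @through i j W x x' y' y hij hW _ hx' hy' _ ihx ihy =>
    obtain ⟨u, hu, hux'⟩ := Metric.mem_thickening_iff.1 hx'
    obtain ⟨v, hv, hvy'⟩ := Metric.mem_thickening_iff.1 hy'
    have hx'y' : dist x' y' ≤ (1 + 4 * s) * σ j := by
      linarith [dist_triangle4 x' u v y', dist_comm v y', h.dist_le j W hW u hu v hv]
    calc dist x y ≤ (1 + 6 * s) * σ j := by linarith [dist_triangle4 x x' y' y]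
      _ ≤ 4 * σ j := mul_le_mul_of_nonneg_right (by linarith [h.s_le]) (h.scale_pos j).le
      _ ≤ s * σ i := by linarith [h.scale_le_of_lt hij]

theorem eq_of_linked (h : IsCoreSystem 𝒞 s σ) {i : ℕ} {U W : Set Z} (hU : U ∈ 𝒞 i) (hW : W ∈ 𝒞 i)
    {x y : Z} (hx : x ∈ Metric.thickening (2 * s * σ i) U)
    (hy : y ∈ Metric.thickening (2 * s * σ i) W)
    (hxy : Linked 𝒞 (fun j => 2 * s * σ j) i x y) : U = W := by
  obtain ⟨u, hu, hxu⟩ := Metric.mem_thickening_iff.1 hx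
  obtain ⟨w, hw, hyw⟩ := Metric.mem_thickening_iff.1 hy
  refine h.eq_of_dist_lt i U hU W hW u hu w hw ?_
  linarith [dist_triangle4 u x y w, dist_comm u x, h.dist_le_of_linked hxy,
    mul_pos h.s_pos (h.scale_pos i)]

/-- Two chains are concatenated at the coarser of their two coarsest cores; if these have the same
level, they are equal by separation, and the part between them is dropped. -/
theorem linked_trans (h : IsCoreSystem 𝒞 s σ) {i : ℕ} {x y z : Z}
    (hxy : Linked 𝒞 (fun j => 2 * s * σ j) i x y) (hyz : Linked 𝒞 (fun j => 2 * s * σ j) i y z) :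
    Linked 𝒞 (fun j => 2 * s * σ j) i x z := by
  induction hxy generalizing z with
  | refl => exact hyz
  | @through i j W x x' y' y hij hW hx hx' hy' hy _ ihy =>
    induction hyz with
    | refl => exact .through hij hW hx hx' hy' hy
    | @through i k V y u v z hik hV hu hu' hv' hv ihu _ =>
      rcases lt_trichotomy j k with hjk | rfl | hkj
      · exact .through hij hW hx hx' hy' (ihy (.through hjk hV hu hu' hv' hv))
      · obtain rfl := h.eq_of_linked hW hV hy' hu' (ihy hu)
        exact .through hij hW hx hx' hv' hv
      · exact .through hik hV (ihu hkj hy ihy) hu' hv' hv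

theorem isLaminar_room (h : IsCoreSystem 𝒞 s σ) :
    IsLaminar (fun i => room 𝒞 (fun j => 2 * s * σ j) i '' 𝒞 i) fun i => s * σ i where
  margin_pos i := mul_pos h.s_pos (h.scale_pos i)
  margin_anti _ _ hij := mul_le_mul_of_nonneg_left (h.scale_anti hij) h.s_pos.le
  eq_of_mem := by
    rintro i _ ⟨U, hU, rfl⟩ _ ⟨W, hW, rfl⟩ x ⟨u, hu, hux⟩ ⟨w, hw, hwx⟩
    have hpos := mul_pos h.s_pos (h.scale_pos i)
    rw [h.eq_of_linked hU hW (Metric.self_subset_thickening (by linarith) U hu)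
      (Metric.self_subset_thickening (by linarith) W hw) (h.linked_trans hux hwx.symm)]
  mem_of_near := by
    rintro i j hij _ ⟨U, -, rfl⟩ _ ⟨W, hW, rfl⟩ x ⟨u, hu, hux⟩ ⟨w, hw, hwx⟩ y ⟨w', hw', hwy⟩ z hyz
    have hpos := mul_pos h.s_pos (h.scale_pos j)
    have hwW : w ∈ Metric.thickening (2 * s * σ j) W :=
      Metric.self_subset_thickening (by linarith) W hw
    have hzW : z ∈ Metric.thickening (2 * s * σ j) W := by
      refine Metric.mem_thickening_iff.2 ⟨w', hw', ?_⟩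
      linarith [dist_triangle_left z w' y, dist_comm w' y, h.dist_le_of_linked hwy]
    exact ⟨u, hu, h.linked_trans hux (.through hij hW hwx.symm hwW hzW (.refl j z))⟩

theorem dist_le_of_mem_room (h : IsCoreSystem 𝒞 s σ) {i : ℕ} {U : Set Z} (hU : U ∈ 𝒞 i) {x y : Z}
    (hx : x ∈ room 𝒞 (fun j => 2 * s * σ j) i U) (hy : y ∈ room 𝒞 (fun j => 2 * s * σ j) i U) :
    dist x y ≤ 2 * σ i := by
  obtain ⟨u, hu, hux⟩ := hx
  obtain ⟨v, hv, hvy⟩ := hy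
  have : s * σ i ≤ 1 / 4 * σ i := mul_le_mul_of_nonneg_right h.s_le (h.scale_pos i).le
  linarith [dist_triangle4 x u v y, dist_comm x u, h.dist_le i U hU u hu v hv,
    h.dist_le_of_linked hux, h.dist_le_of_linked hvy, h.scale_pos i]

end IsCoreSystem

theorem isCoreSystem_of_pairwiseDisjoint {𝒰 : ℕ → Set (Set Z)} {s : ℝ} {σ : ℕ → ℝ} (hs : 0 < s)
    (hs' : s ≤ 1 / 4) (hσ : ∀ i, 0 < σ i) (hσ' : ∀ i, σ (i + 1) ≤ s / 4 * σ i)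
    (hdist : ∀ i, ∀ U ∈ 𝒰 i, ∀ x ∈ U, ∀ y ∈ U, dist x y ≤ σ i)
    (hdisj : ∀ i, (𝒰 i).PairwiseDisjoint id) :
    IsCoreSystem (fun i => (fun U => {z | Metric.ball z (6 * s * σ i) ⊆ U}) '' 𝒰 i) s σ := by
  have mem_of_ball_subset {i : ℕ} {U : Set Z} {z : Z} (h : Metric.ball z (6 * s * σ i) ⊆ U) :
      z ∈ U := h (Metric.mem_ball_self (mul_pos (by linarith) (hσ i)))
  refine ⟨hs, hs', hσ, hσ', ?_, ?_⟩
  · rintro i _ ⟨U, hU, rfl⟩ x hx y hy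
    exact hdist i U hU x (mem_of_ball_subset hx) y (mem_of_ball_subset hy)
  · rintro i _ ⟨U, hU, rfl⟩ _ ⟨W, hW, rfl⟩ x hx y hy hd
    rw [(hdisj i).elim_set hU hW y (hx (Metric.mem_ball'.2 hd)) (mem_of_ball_subset hy)]

end Rooms

theorem CapacityDimProperty.exists_laminar {Z : Type*} [MetricSpace Z] {n : ℕ}
    (h : CapacityDimProperty Z n) :
    ∃ κ r : ℝ, 0 < κ ∧ 0 < r ∧ r < 1 ∧ ∃ 𝒱 : Fin (n + 1) → ℕ → Set (Set Z),
      (∀ c, IsLaminar (𝒱 c) fun i => κ * r ^ i) ∧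
      (∀ c i, ∀ V ∈ 𝒱 c i, ∀ x ∈ V, ∀ y ∈ V, 4 * r * dist x y ≤ κ * r ^ i) ∧
      ∀ i z, ∃ c, ∃ V ∈ 𝒱 c i, Metric.ball z (κ * r ^ i) ⊆ V := by
  obtain ⟨δ, hδ, τ₀, hτ₀, H⟩ := h
  obtain ⟨s, hs, hsδ, hs1⟩ : ∃ s : ℝ, 0 < s ∧ 8 * s ≤ δ ∧ 8 * s ≤ 1 := by
    refine ⟨min δ 1 / 8, by positivity, ?_, ?_⟩
    · linarith [min_le_left δ 1]
    · linarith [min_le_right δ 1]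
  let σ (i : ℕ) : ℝ := τ₀ / 2 * (s / 8) ^ i
  have hσ (i : ℕ) : 0 < σ i := by positivity
  have hσ_le (i : ℕ) : σ i ≤ τ₀ / 2 :=
    mul_le_of_le_one_right (by positivity) (pow_le_one₀ (by positivity) (by linarith))
  have hσ_succ (i : ℕ) : σ (i + 1) ≤ s / 4 * σ i := by
    calc σ (i + 1) = s / 8 * σ i := by simp only [σ, pow_succ]; ring
      _ ≤ s / 4 * σ i := mul_le_mul_of_nonneg_right (by linarith) (hσ i).le
  choose 𝒰 h𝒰 hmesh hleb using fun i => H (σ i) (hσ i) ((hσ_le i).trans_lt (by linarith))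
  let 𝒞 (c : Fin (n + 1)) (i : ℕ) : Set (Set Z) :=
    (fun U => {z | Metric.ball z (6 * s * σ i) ⊆ U}) '' 𝒰 i c
  have hcore (c : Fin (n + 1)) : IsCoreSystem (𝒞 c) s σ :=
    isCoreSystem_of_pairwiseDisjoint hs (by linarith) hσ hσ_succ
      (fun i U hU x hx y hy =>
        dist_le_of_mesh_le (hσ i).le (hmesh i) (Set.mem_iUnion.2 ⟨c, hU⟩) hx hy)
      fun i => (h𝒰 i).disjoint c
  have hμ : (fun i => s * (τ₀ / 2) * (s / 8) ^ i) = fun i => s * σ i :=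
    funext fun i => mul_assoc _ _ _
  refine ⟨s * (τ₀ / 2), s / 8, by positivity, by positivity, by linarith,
    fun c i => room (𝒞 c) (fun j => 2 * s * σ j) i '' 𝒞 c i, fun c => ?_, ?_, fun i z => ?_⟩
  · rw [hμ]
    exact (hcore c).isLaminar_room
  · rintro c i _ ⟨A, hA, rfl⟩ x hx y hy
    have := mul_le_mul_of_nonneg_left ((hcore c).dist_le_of_mem_room hA hx hy) hs.le
    linarith [congrFun hμ i]
  · have hpos := mul_pos hs (hσ i)
    obtain ⟨U, hU, hzU⟩ := exists_ball_subset_of_ofReal_le_lebesgueNumber (hleb i)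
      (mul_pos hδ (hσ i)) (r := 7 * s * σ i) (by nlinarith [hσ i]) z
    obtain ⟨c, hUc⟩ := Set.mem_iUnion.1 hU
    refine ⟨c, _, ⟨_, ⟨U, hUc, rfl⟩, rfl⟩, fun y hy => ⟨y, ?_, .refl i y⟩⟩
    rw [congrFun hμ i] at hy
    exact (Metric.ball_subset_ball' (by linarith [hy.out])).trans hzU

/-! ### Words in the binary metric tree -/

section TreeVertex

theorem treeVertex_apply (u t : List (Fin 3)) :
    (treeVertex u : List (Fin 3) → ℝ) t = if t ≠ [] ∧ t <:+ u then 1 else 0 := by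
  induction u with
  | nil =>
    rw [if_neg fun h => h.1 (List.suffix_nil.1 h.2)]
    rfl
  | cons a w ih =>
    rw [treeVertex, lp.coeFn_add, Pi.add_apply, ih, lp.single_apply]
    rcases eq_or_ne t (a :: w) with rfl | ht
    · have hw : ¬ (a :: w) <:+ w := fun h => by simpa using h.length_le
      rw [if_neg fun h => hw h.2, if_pos ⟨List.cons_ne_nil _ _, List.suffix_refl _⟩,
        Pi.single_eq_same, zero_add]
    · simp only [Pi.single_eq_of_ne ht, add_zero, List.suffix_cons_iff, ht, false_or]

theorem dist_treeVertex_append_le (p u : List (Fin 3)) :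
    dist (treeVertex (p ++ u)) (treeVertex u) ≤ p.length := by
  induction p with
  | nil => simp
  | cons a p ih =>
    have hedge : dist (treeVertex (a :: (p ++ u))) (treeVertex (p ++ u)) = 1 := by
      rw [dist_eq_norm, treeVertex, add_sub_cancel_left, lp.norm_single one_pos, norm_one]
    rw [List.cons_append, List.length_cons, Nat.cast_add_one]
    linarith [dist_triangle (treeVertex (a :: (p ++ u))) (treeVertex (p ++ u)) (treeVertex u)]

/-- The first `k` edges on the way from `u` to the root do not lie on the way from `v`. -/
theorem le_dist_treeVertex {u v : List (Fin 3)} {k : ℕ} (h : ¬ u.drop k <:+ v) :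
    (k : ℝ) ≤ dist (treeVertex u) (treeVertex v) := by
  have hk : k ≤ u.length := by
    by_contra! hlt
    exact h (by rw [List.drop_of_length_le hlt.le]; exact List.nil_suffix)
  have hinj : Set.InjOn (fun i => u.drop i) (Finset.range k : Set ℕ) := by
    intro i hi j hj hij
    have := congrArg List.length hij
    simp only [Finset.coe_range, Set.mem_Iio, List.length_drop] at hi hj this
    omega
  have happly (i : ℕ) (hi : i ∈ Finset.range k) :
      ‖(treeVertex u - treeVertex v : lp (fun _ : List (Fin 3) => ℝ) 1) (u.drop i)‖ = 1 := by
    rw [Finset.mem_range] at hi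
    have hv : ¬ u.drop i <:+ v := fun hv => by
      refine h (List.IsSuffix.trans ?_ hv)
      rw [← Nat.add_sub_cancel' hi.le, ← List.drop_drop]
      exact List.drop_suffix _ _
    have hne : u.drop i ≠ [] := by
      rw [Ne, List.drop_eq_nil_iff]
      omega
    rw [lp.coeFn_sub, Pi.sub_apply, treeVertex_apply, treeVertex_apply,
      if_pos ⟨hne, List.drop_suffix _ _⟩, if_neg fun h => hv h.2, sub_zero, norm_one]
  calc (k : ℝ) = ∑ _i ∈ Finset.range k, 1 := by simp
    _ = ∑ t ∈ (Finset.range k).image fun i => u.drop i,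
        ‖(treeVertex u - treeVertex v : lp (fun _ : List (Fin 3) => ℝ) 1) t‖ := by
      rw [Finset.sum_image hinj, Finset.sum_congr rfl happly]
    _ ≤ dist (treeVertex u) (treeVertex v) := by
      simpa only [ENNReal.toReal_one, Real.rpow_one, dist_eq_norm] using
        lp.sum_rpow_le_norm_rpow (p := 1) (by norm_num) (treeVertex u - treeVertex v) _

/-- The vertex of a reduced word, as a point of the binary metric tree. -/
noncomputable def treePoint (u : List (Fin 3)) (hu : u.IsChain (· ≠ ·)) : BinaryMetricTree :=
  ⟨treeVertex u, by
    cases u with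
    | nil => exact ⟨0, [], by simp, left_mem_segment ℝ _ _⟩
    | cons a w => exact ⟨a, w, hu, right_mem_segment ℝ _ _⟩⟩

theorem dist_treePoint {u v : List (Fin 3)} (hu : u.IsChain (· ≠ ·)) (hv : v.IsChain (· ≠ ·)) :
    dist (treePoint u hu) (treePoint v hv) = dist (treeVertex u) (treeVertex v) := rfl

end TreeVertex

section UniformCode

variable {α β : Type*} {f : α → List β} {m : ℕ}

theorem length_flatMap_of_length_eq (hf : ∀ a, (f a).length = m) (l : List α) :
    (l.flatMap f).length = m * l.length := by
  induction l with
  | nil => simp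
  | cons a l ih => rw [List.flatMap_cons, List.length_append, ih, hf, List.length_cons]; ring

theorem drop_flatMap_of_length_eq (hf : ∀ a, (f a).length = m) (l : List α) (k : ℕ) :
    (l.flatMap f).drop (m * k) = (l.drop k).flatMap f := by
  induction k generalizing l with
  | zero => simp
  | succ k ih =>
    cases l with
    | nil => simp
    | cons a l =>
      rw [List.flatMap_cons, List.drop_succ_cons, ← ih, Nat.mul_succ, Nat.add_comm,
        ← List.drop_drop, List.drop_left' (hf a)]

theorem eq_of_flatMap_eq (hf : ∀ a, (f a).length = m) (hinj : Function.Injective f)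
    {l l' : List α} (hlen : l.length = l'.length) (h : l.flatMap f = l'.flatMap f) : l = l' := by
  induction l generalizing l' with
  | nil => exact (List.length_eq_zero_iff.1 hlen.symm).symm
  | cons a l ih =>
    cases l' with
    | nil => simp at hlen
    | cons a' l' =>
      rw [List.flatMap_cons, List.flatMap_cons] at h
      obtain ⟨ha, hl⟩ := List.append_inj h ((hf a).trans (hf a').symm)
      rw [hinj ha, ih (by simpa using hlen) hl]

theorem suffix_of_flatMap_suffix (hm : 0 < m) (hf : ∀ a, (f a).length = m)
    (hinj : Function.Injective f) {l l' : List α} (h : l.flatMap f <:+ l'.flatMap f) :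
    l <:+ l' := by
  have hlen := h.length_le
  rw [length_flatMap_of_length_eq hf, length_flatMap_of_length_eq hf] at hlen
  replace hlen := Nat.le_of_mul_le_mul_left hlen hm
  have hdrop : l.flatMap f = (l'.drop (l'.length - l.length)).flatMap f := by
    rw [← drop_flatMap_of_length_eq hf, Nat.mul_sub, ← length_flatMap_of_length_eq hf l,
      ← length_flatMap_of_length_eq hf l']
    exact List.suffix_iff_eq_drop.1 h
  rw [eq_of_flatMap_eq hf hinj (by rw [List.length_drop]; omega) hdrop]
  exact List.drop_suffix _ _

end UniformCode

/-- The code of a word of bits by a reduced word of the binary tree. -/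
def bitCode (l : List Bool) : List (Fin 3) := l.flatMap fun b => [0, if b then 2 else 1]

theorem isChain_bitCode (l : List Bool) : (bitCode l).IsChain (· ≠ ·) := by
  induction l with
  | nil => simp [bitCode]
  | cons b l ih =>
    have hb : (if b then 2 else 1 : Fin 3) ≠ 0 := by cases b <;> decide
    cases l with
    | nil => simpa [bitCode] using hb.symm
    | cons b' l =>
      simp only [bitCode, List.flatMap_cons, List.cons_append, List.nil_append,
        List.isChain_cons_cons] at ih ⊢
      exact ⟨hb.symm, hb, ih⟩

theorem exists_uniform_reduced_code (α : Type*) [Finite α] :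
    ∃ (m : ℕ) (f : α → List (Fin 3)), 0 < m ∧ (∀ a, (f a).length = m) ∧ Function.Injective f ∧
      ∀ w : List α, (w.flatMap f).IsChain (· ≠ ·) := by
  obtain ⟨M, ⟨e⟩⟩ := Finite.exists_equiv_fin α
  let bits (a : α) : List Bool := (List.range (M + 1)).map fun i => decide ((e a : ℕ) = i)
  have hcode (l : List Bool) : (bitCode l).length = 2 * l.length :=
    length_flatMap_of_length_eq (m := 2) (fun _ => rfl) l
  refine ⟨2 * (M + 1), fun a => bitCode (bits a), by omega, fun a => ?_, fun a a' h => ?_,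
    fun w => ?_⟩
  · simp only [hcode, bits, List.length_map, List.length_range]
  · have hbits : bits a = bits a' :=
      eq_of_flatMap_eq (m := 2) (fun _ => rfl) (by decide) (by simp [bits]) h
    have := List.map_inj_left.1 hbits (e a) (List.mem_range.2 (by omega))
    simpa [Fin.val_inj, eq_comm] using this
  · simp only [bitCode, ← List.flatMap_assoc]
    exact isChain_bitCode _

theorem exists_tree_coding (α : Type*) [Finite α] :
    ∃ (g : List α → BinaryMetricTree) (b : ℝ), 0 < b ∧
      (∀ p t, dist (g (p ++ t)) (g t) ≤ b * p.length) ∧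
      ∀ w w' (k : ℕ), ¬ w.drop k <:+ w' → (k : ℝ) ≤ dist (g w) (g w') := by
  obtain ⟨m, f, hm, hf, hinj, hchain⟩ := exists_uniform_reduced_code α
  refine ⟨fun w => treePoint (w.flatMap f) (hchain w), m, by exact_mod_cast hm, fun p t => ?_,
    fun w w' k h => ?_⟩
  · rw [dist_treePoint, List.flatMap_append]
    refine (dist_treeVertex_append_le _ _).trans ?_
    rw [length_flatMap_of_length_eq hf, Nat.cast_mul]
  · have hdrop : ¬ (w.flatMap f).drop (m * k) <:+ w'.flatMap f := fun hs =>
      h (suffix_of_flatMap_suffix hm hf hinj (by rwa [drop_flatMap_of_length_eq hf] at hs))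
    rw [dist_treePoint]
    exact le_trans (by exact_mod_cast Nat.le_mul_of_pos_left k hm) (le_dist_treeVertex hdrop)

/-! ### The diary -/

section Diary

variable {α β : Type*} {Λ : ℕ}

/-- A diary is kept over a sequence of batches of entries, newest batch first. The entries that are
not yet written form a stack: with each batch its topmost `Λ` entries are written and removed. -/
def diaryStack (Λ : ℕ) : List (List α) → List α
  | [] => []
  | B :: T => (B ++ diaryStack Λ T).drop Λ

/-- The diary of a sequence of batches: one letter, a list of at most `Λ` entries, per batch. -/
def diary (Λ : ℕ) : List (List α) → List {l : List α // l.length ≤ Λ}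
  | [] => []
  | B :: T => ⟨(B ++ diaryStack Λ T).take Λ, List.length_take_le _ _⟩ :: diary Λ T

theorem length_diary (Λ : ℕ) (Bs : List (List α)) : (diary Λ Bs).length = Bs.length := by
  induction Bs with
  | nil => rfl
  | cons B T ih => rw [diary, List.length_cons, ih, List.length_cons]

theorem drop_diary (Λ : ℕ) (Bs : List (List α)) (n : ℕ) :
    (diary Λ Bs).drop n = diary Λ (Bs.drop n) := by
  induction Bs generalizing n with
  | nil => simp [diary]
  | cons B T ih =>
    cases n with
    | zero => rfl
    | succ n => simpa [diary] using ih n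

theorem take_append_diaryStack_eq {r : ℕ} {B B' : List α} {T T' : List (List α)}
    (h : diary Λ (B :: T) = diary Λ (B' :: T'))
    (hr : (diaryStack Λ (B :: T)).take r = (diaryStack Λ (B' :: T')).take r) :
    (B ++ diaryStack Λ T).take (Λ + r) = (B' ++ diaryStack Λ T').take (Λ + r) := by
  rw [diary, diary, List.cons.injEq, Subtype.mk.injEq] at h
  rw [diaryStack, diaryStack] at hr
  rw [List.take_add, List.take_add, h.1, hr]

/-- The flag `true` marks the last entry of a batch and no other. -/
def IsBatch (B : List (β × Bool)) : Prop := B.findIdx (·.2) + 1 = B.length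

theorem IsBatch.eq_of_take_eq {B B' X X' : List (β × Bool)} {n : ℕ} (hB : IsBatch B)
    (hB' : IsBatch B') (hn : B.length ≤ n) (h : (B ++ X).take n = (B' ++ X').take n) : B = B' := by
  have findIdx_append {C : List (β × Bool)} (hC : IsBatch C) (Y : List (β × Bool)) :
      (C ++ Y).findIdx (·.2) + 1 = C.length := by
    rw [List.findIdx_append, if_pos (by rw [← hC]; omega), hC]
  have happ : B ++ (X.take (n - B.length) ++ (B' ++ X').drop n) = B' ++ X' := by
    rw [← List.append_assoc]
    conv_rhs => rw [← List.take_append_drop n (B' ++ X'), ← h, List.take_append,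
      List.take_of_length_le hn]
  exact (List.append_inj happ (by rw [← findIdx_append hB, happ, findIdx_append hB'])).1

theorem take_eq_take_of_le {l l' : List α} {m n : ℕ} (hmn : m ≤ n) (h : l.take n = l'.take n) :
    l.take m = l'.take m := by
  rw [← min_eq_left hmn, ← List.take_take, h, List.take_take]

/-- By induction on the batches: the first letter of the diary and the known part `r` of the stack
together reveal `Λ + r` entries, those of the newest batch and some of the stack before it. -/
theorem take_flatten_eq_of_diary_eq {S : List (List (β × Bool))} {P P' : List (List (β × Bool))}
    {r n : ℕ} (hP : ∀ B ∈ P, IsBatch B) (hP' : ∀ B ∈ P', IsBatch B) (hlen : P.length = P'.length)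
    (h : diary Λ (P ++ S) = diary Λ (P' ++ S))
    (hr : (diaryStack Λ (P ++ S)).take r = (diaryStack Λ (P' ++ S)).take r) (hn : n ≤ P.length)
    (hbudget : ∀ m ≤ n, (P.take m).flatten.length ≤ Λ * m + r) :
    (P ++ S).flatten.take (Λ * n + r) = (P' ++ S).flatten.take (Λ * n + r) := by
  induction P generalizing P' r n with
  | nil => rw [List.length_eq_zero_iff.1 hlen.symm]
  | cons B P ih =>
    obtain ⟨B', P', rfl⟩ := List.exists_cons_of_length_eq_add_one hlen.symm
    simp only [List.cons_append] at h hr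
    have htake := take_append_diaryStack_eq h hr
    rw [List.forall_mem_cons] at hP hP'
    rcases le_or_gt B.length (Λ + r) with hB | hB
    · obtain rfl := hP.1.eq_of_take_eq hP'.1 hB htake
      rw [List.take_append, List.take_append (l₁ := B)] at htake
      have hrest := ih (r := Λ + r - B.length) (n := n - 1) hP.2 hP'.2 (by simpa using hlen)
        (List.cons.inj h).2 (List.append_cancel_left htake) (by simpa using hn) fun m hm => by
          rcases Nat.eq_zero_or_pos m with rfl | hm0
          · simp
          · have := hbudget (m + 1) (by omega)
            rw [List.take_succ_cons, List.flatten_cons, List.length_append, Nat.mul_succ] at this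
            omega
      have hle : Λ * n + r - B.length ≤ Λ * (n - 1) + (Λ + r - B.length) := by
        cases n with
        | zero => omega
        | succ n => rw [Nat.add_sub_cancel, Nat.mul_succ]; omega
      rw [List.cons_append, List.cons_append, List.flatten_cons, List.flatten_cons,
        List.take_append, List.take_append (l₁ := B), take_eq_take_of_le hle hrest]
    · have hB' : Λ + r < B'.length := by
        by_contra! hle
        exact hB.not_ge (hP'.1.eq_of_take_eq hP.1 hle htake.symm ▸ hle)
      obtain rfl : n = 0 := by
        by_contra hn0
        have := hbudget 1 (Nat.one_le_iff_ne_zero.2 hn0)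
        simp only [List.take_succ_cons, List.take_zero, List.flatten_cons, List.flatten_nil,
          List.append_nil, Nat.mul_one] at this
        omega
      rw [List.take_append_of_le_length hB.le, List.take_append_of_le_length hB'.le] at htake
      rw [List.cons_append, List.cons_append, List.flatten_cons, List.flatten_cons,
        List.take_append_of_le_length (by omega), List.take_append_of_le_length (by omega)]
      exact take_eq_take_of_le (by omega) htake

end Diary

/-! ### The ruler sequence -/

/-- The parity of the exponent of `2` in `l`. The letters `ruler l` added to a history make it
differ from its translates. -/
def ruler (l : ℕ) : Bool := (padicValNat 2 l).bodd

theorem padicValNat_two_pow_mul_odd (e : ℕ) {x : ℕ} (hx : Odd x) :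
    padicValNat 2 (2 ^ e * x) = e := by
  rw [padicValNat.mul (by positivity) hx.pos.ne', padicValNat.prime_pow,
    padicValNat.eq_zero_of_not_dvd hx.not_two_dvd_nat, add_zero]

theorem exists_mul_mem_Ico_modEq (a c : ℕ) {d m : ℕ} (hd : 0 < d) (hm : 0 < m) :
    ∃ x, d * x ∈ Set.Ico a (a + d * m) ∧ x ≡ c [MOD m] := by
  let y := a ⌈/⌉ d
  have hay : a ≤ d * y := le_smul_ceilDiv hd
  have hya : d * y ≤ a + d - 1 := by
    simpa only [y, Nat.ceilDiv_eq_add_pred_div] using Nat.mul_div_le (a + d - 1) d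
  let t := (c + (m - 1) * y) % m
  have ht : d * t + d ≤ d * m := by
    rw [← Nat.mul_succ]
    exact Nat.mul_le_mul_left d (Nat.mod_lt _ hm)
  refine ⟨y + t, ⟨?_, ?_⟩, ?_⟩
  · exact hay.trans (Nat.mul_le_mul_left d (Nat.le_add_right y t))
  · rw [Nat.mul_add]
    omega
  · calc y + t ≡ y + (c + (m - 1) * y) [MOD m] := (Nat.mod_modEq _ _).add_left y
      _ = c + m * y := by
        obtain ⟨m, rfl⟩ := Nat.exists_eq_add_one.2 hm
        rw [Nat.add_sub_cancel]
        ring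
      _ ≡ c [MOD m] := by simp [Nat.ModEq]

/-- If `q = 2 ^ e * u` with `u` odd, the shift by `q` turns the exact exponent `e` of `2` into
`e + 1` at the numbers `2 ^ e * x` with `x + u ≡ 2` modulo `4`. -/
theorem exists_ruler_ne (a : ℕ) {q : ℕ} (hq : 0 < q) :
    ∃ t < 4 * q, ruler (a + t) ≠ ruler (a + t + q) := by
  obtain ⟨e, u, hu, rfl⟩ := Nat.exists_eq_two_pow_mul_odd hq.ne'
  have hu_mod := Nat.odd_iff.1 hu
  obtain ⟨x, ⟨hax, hxa⟩, hx⟩ := exists_mul_mem_Ico_modEq a (3 * u + 2) (d := 2 ^ e)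
    (by positivity) (by norm_num : 0 < 4)
  have hxu : (x + u) % 4 = 2 := by unfold Nat.ModEq at hx; omega
  have hx_odd : Odd x := Nat.odd_iff.2 (by omega)
  have hhalf_odd : Odd ((x + u) / 2) := Nat.odd_iff.2 (by omega)
  have hshift : 2 ^ e * x + 2 ^ e * u = 2 ^ (e + 1) * ((x + u) / 2) := by
    rw [pow_succ, mul_assoc, Nat.mul_div_cancel' (by omega), Nat.mul_add]
  refine ⟨2 ^ e * x - a, ?_, ?_⟩
  · have := Nat.le_mul_of_pos_right (2 ^ e) hu.pos
    omega
  · rw [Nat.add_sub_cancel' hax, hshift, ruler, ruler, padicValNat_two_pow_mul_odd _ hx_odd,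
      padicValNat_two_pow_mul_odd _ hhalf_odd, Nat.bodd_succ]
    exact (Bool.not_ne_self _).symm

/-! ### Diaries of lists of rooms -/

section RuledDiary

variable {ρ β : Type*}

/-- The level of the newest room of a list, `0` for the empty list. -/
def topLevel (lv : ρ → ℕ) : List ρ → ℕ
  | [] => 0
  | U :: _ => lv U

/-- The levels of the rooms, newest first, are positive and decrease strictly. -/
def LevelSorted (lv : ρ → ℕ) : List ρ → Prop
  | [] => True
  | U :: T => topLevel lv T < lv U ∧ LevelSorted lv T

/-- The history of a list of rooms: the room `U` entered after the rooms in `T` contributes the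
entries of the levels from its own down to the one above the level of the preceding room. -/
def batches (lv : ρ → ℕ) (e : ρ → ℕ → β) : List ρ → List (List (β × Bool))
  | [] => []
  | U :: T => ((List.range (lv U - topLevel lv T)).map fun t =>
      (e U (lv U - t), decide (t + 1 = lv U - topLevel lv T))) :: batches lv e T

variable {lv : ρ → ℕ} {e : ρ → ℕ → β}

theorem length_batches (R : List ρ) : (batches lv e R).length = R.length := by
  induction R with
  | nil => rfl
  | cons U T ih => rw [batches, List.length_cons, ih, List.length_cons]

theorem drop_batches (R : List ρ) (n : ℕ) :
    (batches lv e R).drop n = batches lv e (R.drop n) := by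
  induction R generalizing n with
  | nil => simp [batches]
  | cons U T ih =>
    cases n with
    | zero => rfl
    | succ n => simpa [batches] using ih n

theorem batches_suffix {S R : List ρ} (h : S <:+ R) : batches lv e S <:+ batches lv e R := by
  rw [List.suffix_iff_eq_drop.1 h, ← drop_batches]
  exact List.drop_suffix _ _

namespace LevelSorted

variable {R R' S T : List ρ} {Λ n M : ℕ}

theorem of_suffix (hR : LevelSorted lv R) (h : T <:+ R) : LevelSorted lv T := by
  induction R with
  | nil => rwa [List.suffix_nil.1 h]
  | cons U R ih =>
    rcases List.suffix_cons_iff.1 h with rfl | h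
    · exact hR
    · exact ih hR.2 h

theorem topLevel_add_length_le (hR : LevelSorted lv R) (h : T <:+ R) :
    topLevel lv T + R.length ≤ topLevel lv R + T.length := by
  induction R with
  | nil => rw [List.suffix_nil.1 h]
  | cons U R ih =>
    rcases List.suffix_cons_iff.1 h with rfl | h
    · rfl
    · have hRU : topLevel lv R < topLevel lv (U :: R) := hR.1
      have := ih hR.2 h
      rw [List.length_cons]
      omega

theorem topLevel_le_of_suffix (hR : LevelSorted lv R) (h : T <:+ R) :
    topLevel lv T ≤ topLevel lv R := by
  have := hR.topLevel_add_length_le h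
  have := h.length_le
  omega

theorem isBatch (h : LevelSorted lv R) : ∀ B ∈ batches lv e R, IsBatch B := by
  induction R with
  | nil => simp [batches]
  | cons U T ih =>
    rw [batches, List.forall_mem_cons]
    refine ⟨?_, ih h.2⟩
    obtain ⟨m, hm⟩ : ∃ m, lv U - topLevel lv T = m + 1 := Nat.exists_eq_add_one.2
      (Nat.sub_pos_of_lt h.1)
    rw [IsBatch, hm, List.length_map, List.length_range, Nat.add_right_cancel_iff,
      List.findIdx_eq (by simp)]
    refine ⟨by simp, fun t ht => ?_⟩
    simpa using ht.ne

theorem length_flatten_batches (h : LevelSorted lv R) :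
    (batches lv e R).flatten.length = topLevel lv R := by
  induction R with
  | nil => rfl
  | cons U T ih =>
    rw [batches, List.flatten_cons, List.length_append, ih h.2, List.length_map, List.length_range,
      topLevel, Nat.sub_add_cancel h.1.le]

theorem length_flatten_take_batches (h : LevelSorted lv R) (m : ℕ) :
    ((batches lv e R).take m).flatten.length + topLevel lv (R.drop m) = topLevel lv R := by
  rw [← (h.of_suffix (List.drop_suffix m R)).length_flatten_batches (e := e), ← drop_batches,
    ← List.length_append, ← List.flatten_append, List.take_append_drop, h.length_flatten_batches]

theorem getElem?_flatten_batches (h : LevelSorted lv R) {t : ℕ}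
    (ht : t < topLevel lv R) : ∃ U ∈ R, topLevel lv R - t ≤ lv U ∧
      ∃ b, (batches lv e R).flatten[t]? = some (e U (topLevel lv R - t), b) := by
  induction R generalizing t with
  | nil => exact absurd ht (Nat.not_lt_zero t)
  | cons U T ih =>
    have hTU := h.1
    rw [topLevel] at ht ⊢
    by_cases hlt : t < lv U - topLevel lv T
    · refine ⟨U, List.mem_cons_self, Nat.sub_le _ _, decide (t + 1 = lv U - topLevel lv T), ?_⟩
      rw [batches, List.flatten_cons, List.getElem?_append_left (by simpa using hlt)]
      simp [hlt]
    · obtain ⟨W, hW, hle, b, hb⟩ := ih h.2 (t := t - (lv U - topLevel lv T)) (by omega)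
      rw [show topLevel lv T - (t - (lv U - topLevel lv T)) = lv U - t by omega] at hle hb
      refine ⟨W, List.mem_cons_of_mem U hW, hle, b, ?_⟩
      rw [batches, List.flatten_cons, List.getElem?_append_right (by simpa using hlt)]
      simpa using hb

theorem take_flatten_eq_of_diary_eq (hR : LevelSorted lv R) (hR' : LevelSorted lv R')
    (hS : S <:+ R) (hS' : S <:+ R') (hlen : R.length = R'.length)
    (h : diary Λ (batches lv e R) = diary Λ (batches lv e R')) (hn : n + S.length ≤ R.length)
    (hbudget : ∀ m ≤ n, topLevel lv R ≤ topLevel lv (R.drop m) + Λ * m) :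
    (batches lv e R).flatten.take (Λ * n) = (batches lv e R').flatten.take (Λ * n) := by
  obtain ⟨P, hP⟩ := batches_suffix (lv := lv) (e := e) hS
  obtain ⟨P', hP'⟩ := batches_suffix (lv := lv) (e := e) hS'
  have hPlen : P.length + S.length = R.length := by
    simpa only [List.length_append, length_batches] using congrArg List.length hP
  have hPlen' : P'.length + S.length = R'.length := by
    simpa only [List.length_append, length_batches] using congrArg List.length hP'
  have hbatch := hR.isBatch (e := e)
  have hbatch' := hR'.isBatch (e := e)
  rw [← hP] at h hbatch ⊢
  rw [← hP'] at h hbatch' ⊢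
  refine _root_.take_flatten_eq_of_diary_eq (r := 0)
    (fun B hB => hbatch B (List.mem_append_left _ hB))
    (fun B hB => hbatch' B (List.mem_append_left _ hB)) (by omega) h rfl (by omega) fun m hm => ?_
  have hcount := hR.length_flatten_take_batches (e := e) m
  rw [← hP, List.take_append_of_le_length (by omega)] at hcount
  have := hbudget m hm
  omega

theorem exists_entry_eq (hR : LevelSorted lv R) (hR' : LevelSorted lv R')
    (h : (batches lv e R).flatten.take M = (batches lv e R').flatten.take M) {t : ℕ} (htM : t < M)
    (ht : t < topLevel lv R) (ht' : t < topLevel lv R') :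
    ∃ U ∈ R, ∃ U' ∈ R', topLevel lv R - t ≤ lv U ∧ topLevel lv R' - t ≤ lv U' ∧
      e U (topLevel lv R - t) = e U' (topLevel lv R' - t) := by
  obtain ⟨U, hU, hlU, b, hb⟩ := hR.getElem?_flatten_batches (e := e) ht
  obtain ⟨U', hU', hlU', b', hb'⟩ := hR'.getElem?_flatten_batches (e := e) ht'
  refine ⟨U, hU, U', hU', hlU, hlU', ?_⟩
  have hentry := congrArg (fun L => L[t]?) h
  simp only [List.getElem?_take_of_lt htM, hb, hb', Option.some.injEq, Prod.mk.injEq] at hentry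
  exact hentry.1

theorem topLevel_le_of_take_eq {f : ρ → ℕ → β} (hR : LevelSorted lv R) (hR' : LevelSorted lv R')
    (h : (batches lv (fun U l => (f U l, ruler l)) R).flatten.take M =
      (batches lv (fun U l => (f U l, ruler l)) R').flatten.take M)
    (hM : 4 * (topLevel lv R' - topLevel lv R) ≤ M) : topLevel lv R' ≤ topLevel lv R := by
  by_contra! hlt
  have hlen := congrArg List.length h
  rw [List.length_take, List.length_take, hR.length_flatten_batches,
    hR'.length_flatten_batches] at hlen
  set a := topLevel lv R
  obtain ⟨q, hq⟩ := Nat.exists_eq_add_of_lt hlt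
  obtain ⟨t, ht, hne⟩ := exists_ruler_ne (a - 4 * (q + 1) + 1) q.succ_pos
  obtain ⟨U, -, U', -, -, -, heq⟩ := hR.exists_entry_eq hR' h (t := 4 * (q + 1) - 1 - t) (by omega)
    (by omega) (by omega)
  refine hne ?_
  convert (Prod.mk.inj heq).2 using 2 <;> omega

end LevelSorted

/-- The diary of a list of rooms whose history consists of the entries `f U l` and the ruler. -/
def ruledDiary (lv : ρ → ℕ) (f : ρ → ℕ → β) (Λ : ℕ) (R : List ρ) :
    List {l : List ((β × Bool) × Bool) // l.length ≤ Λ} :=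
  diary Λ (batches lv (fun U l => (f U l, ruler l)) R)

variable {f : ρ → ℕ → β} {Λ : ℕ} {R R' S : List ρ}

theorem length_ruledDiary (R : List ρ) : (ruledDiary lv f Λ R).length = R.length := by
  rw [ruledDiary, length_diary, length_batches]

theorem drop_ruledDiary (R : List ρ) (n : ℕ) :
    (ruledDiary lv f Λ R).drop n = ruledDiary lv f Λ (R.drop n) := by
  rw [ruledDiary, ruledDiary, drop_diary, drop_batches]

theorem ruledDiary_suffix (h : S <:+ R) : ruledDiary lv f Λ S <:+ ruledDiary lv f Λ R := by
  rw [List.suffix_iff_eq_drop.1 h, ← drop_ruledDiary]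
  exact List.drop_suffix _ _

/-- The ruler shows that the two histories, which agree from the top on, start at the same level. -/
theorem exists_entry_eq_of_ruledDiary_eq (hR : LevelSorted lv R) (hR' : LevelSorted lv R')
    (hS : S <:+ R) (hS' : S <:+ R') (hlen : R.length = R'.length)
    (h : ruledDiary lv f Λ R = ruledDiary lv f Λ R') {n K l : ℕ} (hn : n + S.length ≤ R.length)
    (hbudget : ∀ m ≤ n, topLevel lv R ≤ topLevel lv (R.drop m) + Λ * m)
    (hK : topLevel lv R ≤ topLevel lv R' + K) (hK' : topLevel lv R' ≤ topLevel lv R + K)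
    (hΛ : 4 * K ≤ Λ * n) (hl : 0 < l) (hlR : l ≤ topLevel lv R) (hRl : topLevel lv R < Λ * n + l) :
    ∃ U ∈ R, ∃ U' ∈ R', l ≤ lv U ∧ l ≤ lv U' ∧ f U l = f U' l := by
  have htake := hR.take_flatten_eq_of_diary_eq hR' hS hS' hlen h hn hbudget
  have htop : topLevel lv R' = topLevel lv R :=
    (hR.topLevel_le_of_take_eq hR' htake (by omega)).antisymm
      (hR'.topLevel_le_of_take_eq hR htake.symm (by omega))
  obtain ⟨U, hU, U', hU', hlU, hlU', heq⟩ := hR.exists_entry_eq hR' htake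
    (t := topLevel lv R - l) (by omega) (by omega) (by omega)
  rw [htop, Nat.sub_sub_self hlR] at hlU' heq
  rw [Nat.sub_sub_self hlR] at hlU
  exact ⟨U, hU, U', hU', hlU, hlU', (Prod.mk.inj heq).1⟩

theorem exists_forall_le_add_mul (φ : ℕ → ℕ) (Λ D : ℕ) :
    ∃ n ≤ D, φ n + Λ * n ≤ φ 0 ∧ ∀ m, n + m ≤ D → φ n ≤ φ (n + m) + Λ * m := by
  obtain ⟨n, hn, hmin⟩ := Finset.exists_min_image (Finset.range (D + 1)) (fun n => φ n + Λ * n)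
    ⟨0, by simp⟩
  simp only [Finset.mem_range, Nat.lt_succ_iff] at hn hmin
  refine ⟨n, hn, by simpa using hmin 0 (Nat.zero_le D), fun m hm => ?_⟩
  have := hmin (n + m) hm
  rw [Nat.mul_add] at this
  omega

theorem exists_suffix_eq_ruledDiary {W : List {l : List ((β × Bool) × Bool) // l.length ≤ Λ}}
    (h : W <:+ ruledDiary lv f Λ R) : ∃ T, T <:+ R ∧ W = ruledDiary lv f Λ T :=
  ⟨_, List.drop_suffix _ R, (List.suffix_iff_eq_drop.1 h).trans (drop_ruledDiary R _)⟩

theorem exists_entry_eq_of_ruledDiary_suffix (hR : LevelSorted lv R) (hR' : LevelSorted lv R')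
    (hS : S <:+ R) (hS' : S <:+ R') {N K C : ℕ}
    (hN : ∀ T, T <:+ R → S.length + 2 < T.length → N < topLevel lv T)
    (hN' : ∀ T, T <:+ R' → S.length + 2 < T.length → N < topLevel lv T)
    (hK : topLevel lv R ≤ N + K) (hK' : topLevel lv R' ≤ N + K)
    (hsuf : ruledDiary lv f Λ R <:+ ruledDiary lv f Λ R') (hlen : S.length + 3 ≤ R.length)
    (hbudget : 5 * K ≤ Λ * (R.length - S.length - 3)) (hΛ : 0 < Λ) (hC : 0 < C)
    (hCK : Λ * C ≤ 4 * K) :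
    ∃ U ∈ R, ∃ U' ∈ R', N + C ≤ lv U ∧ N + C ≤ lv U' ∧ f U (N + C) = f U' (N + C) := by
  -- dropping the newest `n` rooms leaves a history that the diary has kept up with
  obtain ⟨n, hnD, hn, hmin⟩ := exists_forall_le_add_mul (fun n => topLevel lv (R.drop n)) Λ
    (R.length - S.length - 3)
  obtain ⟨D, hD⟩ : ∃ D, R.length = S.length + 3 + n + D := Nat.exists_eq_add_of_le (by omega)
  obtain ⟨R₁, hR₁⟩ : ∃ R₁, R₁ = R.drop n := ⟨_, rfl⟩
  have hsub : R₁ <:+ R := hR₁ ▸ List.drop_suffix n R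
  obtain ⟨R₁', hsub', hword⟩ := exists_suffix_eq_ruledDiary ((ruledDiary_suffix hsub).trans hsuf)
  have hlen₁ : R₁.length = S.length + 3 + D := by rw [hR₁, List.length_drop]; omega
  have hlen₁' : R₁.length = R₁'.length := by
    rw [← length_ruledDiary (lv := lv) (f := f) (Λ := Λ) R₁, hword, length_ruledDiary]
  have hsort := hR.of_suffix hsub
  have hlow : N + D < topLevel lv R₁ := by
    have hdrop := List.drop_suffix D R₁
    have h1 := hsort.topLevel_add_length_le hdrop
    have h2 := hN _ (hdrop.trans hsub) (by rw [List.length_drop]; omega)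
    rw [List.length_drop] at h1
    omega
  have hlow' : N < topLevel lv R₁' := hN' R₁' hsub' (by omega)
  have hup : topLevel lv R₁ ≤ N + K := (hR.topLevel_le_of_suffix hsub).trans hK
  have hup' : topLevel lv R₁' ≤ N + K := (hR'.topLevel_le_of_suffix hsub').trans hK'
  have hbudget₁ : 4 * K < Λ * D := by
    rw [← hR₁, List.drop_zero] at hn
    rw [show R.length - S.length - 3 = n + D by omega, Nat.mul_add] at hbudget
    omega
  have hCD : C ≤ D := Nat.le_of_mul_le_mul_left (hCK.trans hbudget₁.le) hΛ
  obtain ⟨U, hU, U', hU', h⟩ := exists_entry_eq_of_ruledDiary_eq (n := D) (K := K) (l := N + C)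
    hsort (hR'.of_suffix hsub') (List.suffix_of_suffix_length_le hS hsub (by omega))
    (List.suffix_of_suffix_length_le hS' hsub' (by omega)) hlen₁' hword (by omega)
    (fun m hm => by simpa only [hR₁, List.drop_drop] using hmin m (by omega)) (by omega)
    (by omega) hbudget₁.le (by omega) (by omega) (by omega)
  exact ⟨U, hsub.subset hU, U', hsub'.subset hU', h⟩

end RuledDiary

/-! ### The rooms around a set -/

open Classical in
/-- The rooms of the levels `1, …, j` that contain the set `B`, with their levels, newest first. -/
noncomputable def roomList {Z : Type*} (𝒱 : ℕ → Set (Set Z)) (B : Set Z) :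
    ℕ → List (ℕ × Set Z)
  | 0 => []
  | j + 1 => if h : ∃ V ∈ 𝒱 (j + 1), B ⊆ V then (j + 1, h.choose) :: roomList 𝒱 B j
      else roomList 𝒱 B j

section RoomList

variable {Z : Type*} {𝒱 : ℕ → Set (Set Z)} {B B' : Set Z} {i j : ℕ}

theorem roomList_succ_of_exists (h : ∃ V ∈ 𝒱 (j + 1), B ⊆ V) :
    ∃ V ∈ 𝒱 (j + 1), B ⊆ V ∧ roomList 𝒱 B (j + 1) = (j + 1, V) :: roomList 𝒱 B j :=
  ⟨h.choose, h.choose_spec.1, h.choose_spec.2, by rw [roomList, dif_pos h]⟩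

theorem roomList_succ_of_not_exists (h : ¬ ∃ V ∈ 𝒱 (j + 1), B ⊆ V) :
    roomList 𝒱 B (j + 1) = roomList 𝒱 B j := by
  rw [roomList, dif_neg h]

theorem roomList_succ_suffix (j : ℕ) : roomList 𝒱 B j <:+ roomList 𝒱 B (j + 1) := by
  by_cases hex : ∃ V ∈ 𝒱 (j + 1), B ⊆ V
  · obtain ⟨V, -, -, heq⟩ := roomList_succ_of_exists hex
    exact heq ▸ List.suffix_cons _ _
  · exact (roomList_succ_of_not_exists hex).symm ▸ List.suffix_rfl

theorem roomList_suffix (hij : i ≤ j) : roomList 𝒱 B i <:+ roomList 𝒱 B j := by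
  induction hij with
  | refl => exact List.suffix_rfl
  | step _ ih => exact ih.trans (roomList_succ_suffix _)

theorem length_roomList_le (hij : i ≤ j) :
    (roomList 𝒱 B j).length + i ≤ (roomList 𝒱 B i).length + j := by
  induction hij with
  | refl => rfl
  | @step j _ ih =>
    by_cases hex : ∃ V ∈ 𝒱 (j + 1), B ⊆ V
    · obtain ⟨V, -, -, heq⟩ := roomList_succ_of_exists hex
      rw [heq, List.length_cons]
      omega
    · rw [roomList_succ_of_not_exists hex]
      omega

theorem cons_suffix_roomList {U : ℕ × Set Z} {T : List (ℕ × Set Z)}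
    (h : U :: T <:+ roomList 𝒱 B j) :
    U.1 ≤ j ∧ U.2 ∈ 𝒱 U.1 ∧ B ⊆ U.2 ∧ U :: T = roomList 𝒱 B U.1 := by
  induction j with
  | zero => exact absurd (List.suffix_nil.1 h) (List.cons_ne_nil U T)
  | succ j ih =>
    by_cases hex : ∃ V ∈ 𝒱 (j + 1), B ⊆ V
    · obtain ⟨V, hV, hBV, heq⟩ := roomList_succ_of_exists hex
      rw [heq] at h
      rcases List.suffix_cons_iff.1 h with h | h
      · obtain ⟨rfl, rfl⟩ := List.cons.inj h
        exact ⟨le_rfl, hV, hBV, heq.symm⟩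
      · exact ⟨(ih h).1.trans j.le_succ, (ih h).2⟩
    · rw [roomList_succ_of_not_exists hex] at h
      exact ⟨(ih h).1.trans j.le_succ, (ih h).2⟩

theorem mem_roomList {U : ℕ × Set Z} (h : U ∈ roomList 𝒱 B j) :
    U.1 ≤ j ∧ U.2 ∈ 𝒱 U.1 ∧ B ⊆ U.2 := by
  obtain ⟨P, T, hPT⟩ := List.append_of_mem h
  obtain ⟨hUj, hU, hBU, -⟩ := cons_suffix_roomList (T := T) ⟨P, hPT.symm⟩
  exact ⟨hUj, hU, hBU⟩

theorem topLevel_roomList_le (j : ℕ) : topLevel Prod.fst (roomList 𝒱 B j) ≤ j := by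
  cases h : roomList 𝒱 B j with
  | nil => exact Nat.zero_le _
  | cons U T => exact (cons_suffix_roomList ⟨[], h.symm⟩).1

theorem levelSorted_roomList (j : ℕ) : LevelSorted Prod.fst (roomList 𝒱 B j) := by
  induction j with
  | zero => trivial
  | succ j ih =>
    by_cases hex : ∃ V ∈ 𝒱 (j + 1), B ⊆ V
    · obtain ⟨V, -, -, heq⟩ := roomList_succ_of_exists hex
      rw [heq]
      exact ⟨Nat.lt_succ_of_le (topLevel_roomList_le j), ih⟩
    · rwa [roomList_succ_of_not_exists hex]

theorem lt_topLevel_of_suffix_roomList {T : List (ℕ × Set Z)} (hT : T <:+ roomList 𝒱 B j)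
    (hlen : (roomList 𝒱 B i).length < T.length) : i < topLevel Prod.fst T := by
  cases T with
  | nil => exact absurd hlen (Nat.not_lt_zero _)
  | cons U T =>
    by_contra! hle
    have := (roomList_suffix (𝒱 := 𝒱) (B := B) (show U.1 ≤ i from hle)).length_le
    rw [← (cons_suffix_roomList hT).2.2.2] at this
    omega

theorem add_sum_length_roomList_le {n : ℕ} {𝒱 : Fin n → ℕ → Set (Set Z)} {N k : ℕ} (hN : N ≤ k)
    (h : ∀ j ≤ k, ∃ c, ∃ V ∈ 𝒱 c j, B ⊆ V) :
    k + ∑ c, (roomList (𝒱 c) B N).length ≤ N + ∑ c, (roomList (𝒱 c) B k).length := by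
  induction hN with
  | refl => rfl
  | @step k _ ih =>
    have hlt : ∑ c, (roomList (𝒱 c) B k).length < ∑ c, (roomList (𝒱 c) B (k + 1)).length := by
      obtain ⟨c, hc⟩ := h (k + 1) le_rfl
      obtain ⟨V, -, -, heq⟩ := roomList_succ_of_exists hc
      refine Finset.sum_lt_sum (fun c _ => (roomList_succ_suffix k).length_le)
        ⟨c, Finset.mem_univ c, ?_⟩
      rw [heq]
      exact Nat.lt_succ_self _
    have := ih fun j hj => h j (hj.trans k.le_succ)
    rw [Nat.succ_eq_add_one]
    omega

theorem exists_color_le_mul_length_roomList {n : ℕ} {𝒱 : Fin (n + 1) → ℕ → Set (Set Z)} {N k : ℕ}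
    (hN : N ≤ k) (h : ∀ j ≤ k, ∃ c, ∃ V ∈ 𝒱 c j, B ⊆ V) :
    ∃ c, k + (n + 1) * (roomList (𝒱 c) B N).length ≤
      N + (n + 1) * (roomList (𝒱 c) B k).length := by
  obtain ⟨c, -, hc⟩ := Finset.exists_le_of_sum_le (s := Finset.univ)
    (f := fun c => k + (n + 1) * (roomList (𝒱 c) B N).length)
    (g := fun c => N + (n + 1) * (roomList (𝒱 c) B k).length) Finset.univ_nonempty (by
      have := Nat.mul_le_mul_left (n + 1) (add_sum_length_roomList_le hN h)
      simpa [Finset.sum_add_distrib, ← Finset.mul_sum, mul_add] using this)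
  exact ⟨c, hc⟩

variable [MetricSpace Z] {μ : ℕ → ℝ}

theorem IsLaminar.subset (h : IsLaminar 𝒱 μ) (hij : i ≤ j) {V W : Set Z} (hV : V ∈ 𝒱 i)
    (hW : W ∈ 𝒱 j) {x : Z} (hxV : x ∈ V) (hxW : x ∈ W) : W ⊆ V := by
  rcases hij.lt_or_eq with hlt | rfl
  · exact fun y hy => h.mem_of_near i j hlt V hV W hW x hxV hxW y hy y
      (by rw [dist_self]; exact h.margin_pos j)
  · exact (h.eq_of_mem i V hV W hW x hxV hxW).ge

theorem IsLaminar.roomList_eq (h : IsLaminar 𝒱 μ) (hB : B.Nonempty) (hB' : B'.Nonempty)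
    {V : Set Z} (hV : V ∈ 𝒱 i) (hBV : B ⊆ V) (hBV' : B' ⊆ V) (hji : j ≤ i) :
    roomList 𝒱 B j = roomList 𝒱 B' j := by
  have subset_of_subset {B B' : Set Z} (hB : B.Nonempty) (hBV : B ⊆ V) (hBV' : B' ⊆ V) {m : ℕ}
      (hm : m ≤ i) {W : Set Z} (hW : W ∈ 𝒱 m) (hBW : B ⊆ W) : B' ⊆ W := by
    obtain ⟨x, hx⟩ := hB
    exact hBV'.trans (h.subset hm hW hV (hBW hx) (hBV hx))
  induction j with
  | zero => rfl
  | succ j ih =>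
    by_cases hex : ∃ W ∈ 𝒱 (j + 1), B ⊆ W
    · obtain ⟨W, hW, hBW, heq⟩ := roomList_succ_of_exists hex
      have hBW' := subset_of_subset hB hBV hBV' hji hW hBW
      obtain ⟨W', hW', hBW'', heq'⟩ := roomList_succ_of_exists ⟨W, hW, hBW'⟩
      obtain ⟨x, hx⟩ := hB'
      rw [heq, heq', ih (by omega), h.eq_of_mem _ W hW W' hW' x (hBW' hx) (hBW'' hx)]
    · have hex' : ¬ ∃ W ∈ 𝒱 (j + 1), B' ⊆ W := fun ⟨W, hW, hBW⟩ =>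
        hex ⟨W, hW, subset_of_subset hB' hBV' hBV hji hW hBW⟩
      rw [roomList_succ_of_not_exists hex, roomList_succ_of_not_exists hex', ih (by omega)]

variable {z z' : Z} {k k' N : ℕ}

/-- A room contains a neighbourhood of every finer room that it meets: so the second newest room
about `z` contains `z'`, and the third newest one contains a ball around `z'`. -/
theorem IsLaminar.drop_two_roomList_suffix (h : IsLaminar 𝒱 μ) (hk' : N ≤ k')
    (hd : dist z z' < μ N) :
    (roomList 𝒱 (Metric.ball z (μ k)) N).drop 2 <:+ roomList 𝒱 (Metric.ball z' (μ k')) N := by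
  set B := Metric.ball z (μ k)
  have hzB : z ∈ B := Metric.mem_ball_self (h.margin_pos k)
  have hzB' : z' ∈ Metric.ball z' (μ k') := Metric.mem_ball_self (h.margin_pos k')
  have hsort := levelSorted_roomList (𝒱 := 𝒱) (B := B) N
  match hR : roomList 𝒱 B N with
  | [] | [_] | [_, _] => exact List.nil_suffix
  | U₃ :: U₂ :: U₁ :: T =>
    have hsuf₃ : U₃ :: U₂ :: U₁ :: T <:+ roomList 𝒱 B N := hR ▸ List.suffix_rfl
    have hsuf₂ := (List.suffix_cons _ _).trans hsuf₃
    rw [hR] at hsort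
    obtain ⟨hle₃, hU₃, hBU₃, -⟩ := cons_suffix_roomList hsuf₃
    obtain ⟨hle₂, hU₂, hBU₂, -⟩ := cons_suffix_roomList hsuf₂
    obtain ⟨hle₁, hU₁, hBU₁, heq⟩ := cons_suffix_roomList ((List.suffix_cons _ _).trans hsuf₂)
    have hz'U₂ : z' ∈ U₂.2 := h.mem_of_near _ _ hsort.1 _ hU₂ _ hU₃ z (hBU₂ hzB) (hBU₃ hzB) z
      (hBU₃ hzB) z' (hd.trans_le (h.margin_anti hle₃))
    have hB'U₁ : Metric.ball z' (μ k') ⊆ U₁.2 := fun w hw =>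
      h.mem_of_near _ _ hsort.2.1 _ hU₁ _ hU₂ z (hBU₁ hzB) (hBU₂ hzB) z' hz'U₂ w
        ((Metric.mem_ball'.1 hw).trans_le (h.margin_anti (hle₂.trans hk')))
    rw [show (U₃ :: U₂ :: U₁ :: T).drop 2 = roomList 𝒱 B U₁.1 from heq,
      h.roomList_eq ⟨z, hzB⟩ ⟨z', hzB'⟩ hU₁ hBU₁ hB'U₁ le_rfl]
    exact roomList_suffix hle₁

theorem IsLaminar.exists_common_suffix (h : IsLaminar 𝒱 μ) (hk : N ≤ k) (hk' : N ≤ k')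
    (hd : N = 0 ∨ dist z z' < μ N) :
    ∃ S, S <:+ roomList 𝒱 (Metric.ball z (μ k)) N ∧ S <:+ roomList 𝒱 (Metric.ball z' (μ k')) N ∧
      (roomList 𝒱 (Metric.ball z (μ k)) N).length ≤ S.length + 2 ∧
      (roomList 𝒱 (Metric.ball z' (μ k')) N).length ≤ S.length + 2 := by
  rcases hd with rfl | hd
  · exact ⟨[], List.nil_suffix, List.nil_suffix, Nat.zero_le _, Nat.zero_le _⟩
  have hsuf := h.drop_two_roomList_suffix (k := k) hk' hd
  have hsuf' := h.drop_two_roomList_suffix (k := k') hk (by rwa [dist_comm])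
  rcases le_total (roomList 𝒱 (Metric.ball z (μ k)) N).length
    (roomList 𝒱 (Metric.ball z' (μ k')) N).length with hle | hle
  · exact ⟨_, hsuf', List.drop_suffix _ _, by rw [List.length_drop]; omega,
      by rw [List.length_drop]; omega⟩
  · exact ⟨_, List.drop_suffix _ _, hsuf, by rw [List.length_drop]; omega,
      by rw [List.length_drop]; omega⟩

end RoomList

/-! ### Embedding the hyperbolic cone into a product of trees -/

/-- `N` is the level at which the vertical geodesics of the hyperbolic cone from the points
`(z, k)` and `(z', k')` up to the apex meet: the last level, at most `k` and `k'`, whose scale `μ N`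
exceeds the distance of `z` and `z'`. In the cone these points are at distance `k + k' - 2 N` up to
a constant. -/
structure IsBranchLevel {Z : Type*} [MetricSpace Z] (μ : ℕ → ℝ) (z z' : Z) (k k' N : ℕ) :
    Prop where
  le_left : N ≤ k
  le_right : N ≤ k'
  close : N = 0 ∨ dist z z' < μ N
  far : N = k ∨ N = k' ∨ μ (N + 1) ≤ dist z z'

/-- The word of the cone point `(z, k)`: the diary of the rooms up to level `k` which contain the
ball of radius `μ k` around `z`, in which the entry of a room at level `l` is its color `χ l`. -/
noncomputable def roomWord {Z β : Type*} [MetricSpace Z] (𝒱 : ℕ → Set (Set Z)) (μ : ℕ → ℝ)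
    (χ : ℕ → Set Z → β) (Λ : ℕ) (z : Z) (k : ℕ) :
    List {l : List ((β × Bool) × Bool) // l.length ≤ Λ} :=
  ruledDiary Prod.fst (fun U l => χ l U.2) Λ (roomList 𝒱 (Metric.ball z (μ k)) k)

/-- Colorings `χ l` of the rooms that tell points at scale `μ l` from points at scale `μ (l + 1)`:
if two rooms of level at least `l + 2` have the same color `χ (l + 2)`, then they are either far
apart at scale `μ l` or close at scale `μ (l + 1)`. -/
def IsScaleColoring {Z β : Type*} [MetricSpace Z] (𝒱 : ℕ → Set (Set Z)) (μ : ℕ → ℝ)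
    (χ : ℕ → Set Z → β) : Prop :=
  ∀ l i j, l + 2 ≤ i → l + 2 ≤ j → ∀ V ∈ 𝒱 i, ∀ W ∈ 𝒱 j, χ (l + 2) V = χ (l + 2) W →
    ∀ x ∈ V, ∀ y ∈ W, l = 0 ∨ dist x y < μ l → dist x y < μ (l + 1)

section Cone

variable {Z : Type*} [MetricSpace Z]

theorem exists_isBranchLevel (μ : ℕ → ℝ) (z z' : Z) (k k' : ℕ) :
    ∃ N, IsBranchLevel μ z z' k k' N := by
  classical
  let P (N : ℕ) : Prop := N = 0 ∨ dist z z' < μ N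
  obtain ⟨hk, hk'⟩ := le_min_iff.1 (Nat.findGreatest_le (P := P) (min k k'))
  refine ⟨Nat.findGreatest P (min k k'), hk, hk',
    Nat.findGreatest_spec (P := P) (Nat.zero_le _) (Or.inl rfl), ?_⟩
  by_contra! hfar
  exact absurd (Nat.le_findGreatest (P := P) (le_min (hk.lt_of_ne hfar.1) (hk'.lt_of_ne hfar.2.1))
    (Or.inr hfar.2.2)) (Nat.not_succ_le_self _)

theorem IsDoublingSpace.exists_isScaleColoring (hZ : IsDoublingSpace Z) {Δ : ℝ}
    (hΔ : ∀ x y : Z, dist x y ≤ Δ) {κ r : ℝ} (hκ : 0 < κ) (hr : 0 < r) (hr1 : r < 1) :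
    ∃ (Q : ℕ) (χ : ℕ → Set Z → Fin (Q + 1)), ∀ 𝒱 : ℕ → Set (Set Z),
      (∀ i, ∀ V ∈ 𝒱 i, ∀ x ∈ V, ∀ y ∈ V, 4 * r * dist x y ≤ κ * r ^ i) →
        IsScaleColoring 𝒱 (fun i => κ * r ^ i) χ := by
  obtain ⟨Q, hQ⟩ := hZ.exists_coloring_sets (8 * max κ Δ / (κ * r))
  choose χ hχ using fun l : ℕ => hQ (κ * r ^ l / (8 * r)) (by positivity)
  refine ⟨Q, χ, fun 𝒱 hdiam l i j hi hj V hV W hW hVW x hx y hy hxy => ?_⟩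
  have hdiam' {i : ℕ} (hi : l + 2 ≤ i) {V : Set Z} (hV : V ∈ 𝒱 i) :
      ∀ x ∈ V, ∀ y ∈ V, dist x y ≤ 2 * (κ * r ^ (l + 2) / (8 * r)) := fun x hx y hy => by
    have hanti : κ * r ^ i ≤ κ * r ^ (l + 2) :=
      mul_le_mul_of_nonneg_left (pow_le_pow_of_le_one hr.le hr1.le hi) hκ.le
    rw [← mul_div_assoc, le_div_iff₀ (by positivity)]
    linarith [hdiam i V hV x hx y hy]
  have hscale : 8 * max κ Δ / (κ * r) * (κ * r ^ (l + 2) / (8 * r)) = max κ Δ * r ^ l := by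
    field_simp
    ring
  have hxy' : dist x y ≤ max κ Δ * r ^ l := by
    rcases hxy with rfl | hxy
    · simpa using Or.inr (hΔ x y)
    · exact hxy.le.trans (mul_le_mul_of_nonneg_right (le_max_left κ Δ) (by positivity))
  calc dist x y ≤ 6 * (κ * r ^ (l + 2) / (8 * r)) :=
        hχ (l + 2) V W hVW (hdiam' hi hV) (hdiam' hj hW) x hx y hy (hxy'.trans_eq hscale.symm)
    _ = 3 / 4 * (κ * r ^ (l + 1)) := by field_simp; ring
    _ < κ * r ^ (l + 1) := by
        have : 0 < κ * r ^ (l + 1) := by positivity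
        linarith

variable {𝒱 : ℕ → Set (Set Z)} {μ : ℕ → ℝ} {β : Type*} {χ : ℕ → Set Z → β} {Λ : ℕ} {z z' : Z}
  {k k' N : ℕ}

namespace IsBranchLevel

theorem symm (hb : IsBranchLevel μ z z' k k' N) : IsBranchLevel μ z' z k' k N where
  le_left := hb.le_right
  le_right := hb.le_left
  close := by simpa only [dist_comm] using hb.close
  far := by simpa only [dist_comm, or_left_comm] using hb.far

theorem exists_roomWord_eq_append (hb : IsBranchLevel μ z z' k k' N) (h : IsLaminar 𝒱 μ) :
    ∃ p p' t, roomWord 𝒱 μ χ Λ z k = p ++ t ∧ roomWord 𝒱 μ χ Λ z' k' = p' ++ t ∧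
      p.length + p'.length + 2 * N ≤ k + k' + 4 := by
  obtain ⟨S, hS, hS', hlen, hlen'⟩ := h.exists_common_suffix hb.le_left hb.le_right hb.close
  obtain ⟨p, hp⟩ := ruledDiary_suffix (lv := Prod.fst) (f := fun U l => χ l U.2) (Λ := Λ)
    (hS.trans (roomList_suffix hb.le_left))
  obtain ⟨p', hp'⟩ := ruledDiary_suffix (lv := Prod.fst) (f := fun U l => χ l U.2) (Λ := Λ)
    (hS'.trans (roomList_suffix hb.le_right))
  refine ⟨p, p', _, hp.symm, hp'.symm, ?_⟩
  have hpl := congrArg List.length hp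
  have hpl' := congrArg List.length hp'
  rw [List.length_append, length_ruledDiary, length_ruledDiary] at hpl hpl'
  have := length_roomList_le (𝒱 := 𝒱) (B := Metric.ball z (μ k)) hb.le_left
  have := length_roomList_le (𝒱 := 𝒱) (B := Metric.ball z' (μ k')) hb.le_right
  omega

theorem not_drop_roomWord_suffix (hb : IsBranchLevel μ z z' k k' N) (h : IsLaminar 𝒱 μ)
    (hχ : IsScaleColoring 𝒱 μ χ) (hk : k' ≤ k) {j q : ℕ}
    (hlen : (roomList 𝒱 (Metric.ball z (μ k)) N).length + q + 3 + j ≤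
      (roomList 𝒱 (Metric.ball z (μ k)) k).length)
    (hbudget : 5 * (k - N) ≤ Λ * q) (hΛ : 0 < Λ) (hΛk : Λ * 2 ≤ 4 * (k - N)) :
    ¬ (roomWord 𝒱 μ χ Λ z k).drop j <:+ roomWord 𝒱 μ χ Λ z' k' := by
  intro hsuf
  rw [roomWord, roomWord, drop_ruledDiary] at hsuf
  obtain ⟨S, hS, hS', hlenS, hlenS'⟩ := h.exists_common_suffix hb.le_left hb.le_right hb.close
  have hdrop := List.drop_suffix j (roomList 𝒱 (Metric.ball z (μ k)) k)
  have hlenR := List.length_drop (i := j) (l := roomList 𝒱 (Metric.ball z (μ k)) k)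
  have hSle := hS.length_le
  have hNk := hb.le_left
  obtain ⟨U, hU, U', hU', hlU, hlU', hUU'⟩ := exists_entry_eq_of_ruledDiary_suffix (N := N)
    (K := k - N) (C := 2) ((levelSorted_roomList k).of_suffix hdrop) (levelSorted_roomList k')
    (List.suffix_of_suffix_length_le (hS.trans (roomList_suffix hb.le_left)) hdrop (by omega))
    (hS'.trans (roomList_suffix hb.le_right))
    (fun T hT hlenT => lt_topLevel_of_suffix_roomList (hT.trans hdrop) (by omega))
    (fun T hT hlenT => lt_topLevel_of_suffix_roomList hT (by omega))
    (((levelSorted_roomList k).topLevel_le_of_suffix hdrop).trans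
      ((topLevel_roomList_le k).trans (by omega)))
    ((topLevel_roomList_le k').trans (by omega)) hsuf (by omega)
    (hbudget.trans (Nat.mul_le_mul_left Λ (by omega))) hΛ two_pos hΛk
  obtain ⟨hUk, hUV, hzU⟩ := mem_roomList (hdrop.subset hU)
  obtain ⟨hUk', hUV', hzU'⟩ := mem_roomList hU'
  have hlt : dist z z' < μ (N + 1) := hχ N U.1 U'.1 hlU hlU' U.2 hUV U'.2 hUV' hUU' z
    (hzU (Metric.mem_ball_self (h.margin_pos k))) z'
    (hzU' (Metric.mem_ball_self (h.margin_pos k'))) hb.close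
  rcases hb.far with rfl | rfl | hfar
  · omega
  · omega
  · exact hfar.not_gt hlt

theorem exists_color_not_drop_roomWord_suffix {n : ℕ} {𝒱 : Fin (n + 1) → ℕ → Set (Set Z)}
    (hb : IsBranchLevel μ z z' k k' N) (h : ∀ c, IsLaminar (𝒱 c) μ)
    (hχ : ∀ c, IsScaleColoring (𝒱 c) μ χ)
    (hcov : ∀ i z, ∃ c, ∃ V ∈ 𝒱 c i, Metric.ball z (μ i) ⊆ V) (hk : k' ≤ k) :
    ∃ c j, k - N ≤ (n + 1) * (2 * j + 24) ∧
      (j = 0 ∨ ¬ (roomWord (𝒱 c) μ χ (24 * (n + 1)) z k).drop j <:+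
        roomWord (𝒱 c) μ χ (24 * (n + 1)) z' k') := by
  rcases le_total (k - N) (24 * (n + 1)) with hsmall | hlarge
  · exact ⟨0, 0, by omega, Or.inl rfl⟩
  obtain ⟨c, hc⟩ := exists_color_le_mul_length_roomList (𝒱 := 𝒱) (B := Metric.ball z (μ k))
    hb.le_left fun j hj => by
      obtain ⟨c, V, hV, hzV⟩ := hcov j z
      exact ⟨c, V, hV, (Metric.ball_subset_ball ((h c).margin_anti hj)).trans hzV⟩
  obtain ⟨m, hm⟩ := Nat.exists_eq_add_of_le
    (roomList_suffix (𝒱 := 𝒱 c) (B := Metric.ball z (μ k)) hb.le_left).length_le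
  have hkm : k - N ≤ (n + 1) * m := by
    rw [hm, Nat.mul_add] at hc
    omega
  have hm24 : 24 ≤ m :=
    Nat.le_of_mul_le_mul_left (show (n + 1) * 24 ≤ (n + 1) * m by omega) n.succ_pos
  refine ⟨c, m / 2, hkm.trans (Nat.mul_le_mul_left _ (by omega)), Or.inr
    (hb.not_drop_roomWord_suffix (h c) (hχ c) hk (q := m / 3) (by omega) ?_ (by omega) (by omega))⟩
  calc 5 * (k - N) ≤ (n + 1) * (5 * m) := by linarith
    _ ≤ (n + 1) * (24 * (m / 3)) := Nat.mul_le_mul_left _ (by omega)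
    _ = 24 * (n + 1) * (m / 3) := by ring

theorem dist_roomWord_le {Y : Type*} [PseudoMetricSpace Y]
    {g : List {l : List ((β × Bool) × Bool) // l.length ≤ Λ} → Y} {b : ℝ}
    (hb : IsBranchLevel μ z z' k k' N) (h : IsLaminar 𝒱 μ) (hb0 : 0 ≤ b)
    (hlip : ∀ p t, dist (g (p ++ t)) (g t) ≤ b * p.length) :
    dist (g (roomWord 𝒱 μ χ Λ z k)) (g (roomWord 𝒱 μ χ Λ z' k')) ≤ b * (k + k' - 2 * N + 4) := by
  obtain ⟨p, p', t, hp, hp', hlen⟩ := hb.exists_roomWord_eq_append (χ := χ) (Λ := Λ) h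
  have hlen : (p.length : ℝ) + p'.length + 2 * N ≤ k + k' + 4 := by exact_mod_cast hlen
  rw [hp, hp']
  calc dist (g (p ++ t)) (g (p' ++ t)) ≤ b * p.length + b * p'.length :=
        (dist_triangle_right _ _ (g t)).trans (add_le_add (hlip p t) (hlip p' t))
    _ = b * (p.length + p'.length) := by ring
    _ ≤ b * (k + k' - 2 * N + 4) := mul_le_mul_of_nonneg_left (by linarith) hb0

end IsBranchLevel

theorem exists_cone_embedding (hdoub : IsDoublingSpace Z) {n : ℕ} (hcap : CapacityDimProperty Z n)
    {Δ : ℝ} (hΔ : ∀ x y : Z, dist x y ≤ Δ) :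
    ∃ (κ r A C : ℝ) (F : Z → ℕ → Fin (n + 1) → BinaryMetricTree),
      0 < κ ∧ 0 < r ∧ r < 1 ∧ 0 < A ∧ 0 < C ∧ ∀ z z' k k' N,
        IsBranchLevel (fun i => κ * r ^ i) z z' k k' N →
          A * (k + k' - 2 * N) - C ≤ dist (F z k) (F z' k') ∧
            dist (F z k) (F z' k') ≤ C * (k + k' - 2 * N) + C := by
  obtain ⟨κ, r, hκ, hr, hr1, 𝒱, hlam, hdiam, hcov⟩ := hcap.exists_laminar
  obtain ⟨Q, χ, hχ⟩ := hdoub.exists_isScaleColoring hΔ hκ hr hr1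
  have hfin : Finite {l : List ((Fin (Q + 1) × Bool) × Bool) // l.length ≤ 24 * (n + 1)} :=
    (List.finite_length_le _ _).to_subtype
  obtain ⟨g, b, hb, hlip, hsep⟩ := exists_tree_coding
    {l : List ((Fin (Q + 1) × Bool) × Bool) // l.length ≤ 24 * (n + 1)}
  let F (z : Z) (k : ℕ) (c : Fin (n + 1)) : BinaryMetricTree :=
    g (roomWord (𝒱 c) (fun i => κ * r ^ i) χ (24 * (n + 1)) z k)
  have lower {z z' k k' N} (hN : IsBranchLevel (fun i => κ * r ^ i) z z' k k' N) (hk : k' ≤ k) :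
      1 / (4 * (n + 1)) * ((k : ℝ) + k' - 2 * N) - 12 ≤ dist (F z k) (F z' k') := by
    obtain ⟨c, j, hj, hnot⟩ := hN.exists_color_not_drop_roomWord_suffix hlam
      (fun c => hχ _ (hdiam c)) hcov hk
    have hjd : (j : ℝ) ≤ dist (F z k) (F z' k') := by
      rcases hnot with rfl | hnot
      · exact_mod_cast dist_nonneg
      · exact (hsep _ _ j hnot).trans (dist_le_pi_dist (F z k) (F z' k') c)
    have hj : (k : ℝ) - N ≤ (n + 1) * (2 * j + 24) := by
      rw [← Nat.cast_sub hN.le_left]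
      exact_mod_cast hj
    have hk : (k' : ℝ) ≤ k := by exact_mod_cast hk
    rw [sub_le_iff_le_add, one_div_mul_eq_div, div_le_iff₀ (by positivity)]
    nlinarith
  refine ⟨κ, r, 1 / (4 * (n + 1)), 12 + 4 * b, F, hκ, hr, hr1, by positivity, by positivity,
    fun z z' k k' N hN => ⟨?_, ?_⟩⟩
  · rcases le_total k' k with hk | hk
    · linarith [lower hN hk]
    · rw [dist_comm, add_comm (k : ℝ)]
      linarith [lower hN.symm hk]
  · have hkN : (N : ℝ) ≤ k := by exact_mod_cast hN.le_left
    have hkN' : (N : ℝ) ≤ k' := by exact_mod_cast hN.le_right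
    refine (dist_pi_le_iff (by nlinarith)).2 fun c => ?_
    exact (hN.dist_roomWord_le (hlam c) hb.le hlip).trans (by nlinarith)

end Cone

/-! ### Comparison of a visual hyperbolic space with the cone over its boundary -/

section GromovProduct

variable {X : Type*} [MetricSpace X]

theorem gromovProd_comm (o x y : X) : gromovProd o x y = gromovProd o y x := by
  rw [gromovProd, gromovProd, dist_comm x y, add_comm (dist o x)]

theorem gromovProd_nonneg (o x y : X) : 0 ≤ gromovProd o x y := by
  rw [gromovProd]
  linarith [dist_triangle_left x y o]

theorem gromovProd_le_left (o x y : X) : gromovProd o x y ≤ dist o x := by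
  rw [gromovProd]
  linarith [dist_triangle o x y]

theorem gromovProd_le_right (o x y : X) : gromovProd o x y ≤ dist o y := by
  rw [gromovProd_comm]
  exact gromovProd_le_left o y x

theorem gromovProd_chain {δ : ℝ} (hδ : 0 ≤ δ)
    (h : ∀ o x y z : X, min (gromovProd o x y) (gromovProd o y z) - δ ≤ gromovProd o x z)
    {o x u v y : X} {t : ℝ} (hxu : t ≤ gromovProd o x u) (huv : t ≤ gromovProd o u v)
    (hvy : t ≤ gromovProd o v y) : t - 2 * δ ≤ gromovProd o x y := by
  have hxv : t - δ ≤ gromovProd o x v :=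
    (sub_le_sub_right (le_min hxu huv) δ).trans (h o x u v)
  have hmin : t - δ ≤ min (gromovProd o x v) (gromovProd o v y) := le_min hxv (by linarith)
  linarith [h o x v y]

variable [GromovHyperbolic X]

theorem GromovBoundary.exists_mem (ξ : GromovBoundary X) : ∃ x, ξ.Mem x := by
  obtain ⟨x, rfl⟩ := Quotient.exists_rep ξ
  exact ⟨x.1, x.2, rfl⟩

theorem boundaryProd_nonneg (o : X) (ξ ξ' : GromovBoundary X) : 0 ≤ boundaryProd o ξ ξ' :=
  le_iInf₂ fun x _ => le_iInf₂ fun x' _ => le_liminf_of_le (by isBoundedDefault)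
    (Eventually.of_forall fun i => by exact_mod_cast gromovProd_nonneg o (x i) (x' i))

theorem eventually_lt_gromovProd_of_lt_pointBoundaryProd {o y : X} {ξ : GromovBoundary X} {t : ℝ}
    (h : (t : EReal) < pointBoundaryProd o y ξ) {x : ℕ → X} (hx : ξ.Mem x) :
    ∀ᶠ i in atTop, t < gromovProd o y (x i) :=
  (eventually_lt_of_lt_liminf (h.trans_le (iInf₂_le x hx))).mono fun _ => EReal.coe_lt_coe_iff.1

theorem eventually_lt_gromovProd_of_lt_boundaryProd {o : X} {ξ ξ' : GromovBoundary X} {t : ℝ}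
    (h : (t : EReal) < boundaryProd o ξ ξ') {x x' : ℕ → X} (hx : ξ.Mem x) (hx' : ξ'.Mem x') :
    ∀ᶠ i in atTop, t < gromovProd o (x i) (x' i) :=
  (eventually_lt_of_lt_liminf (h.trans_le ((iInf₂_le x hx).trans (iInf₂_le x' hx')))).mono
    fun _ => EReal.coe_lt_coe_iff.1

theorem exists_frequently_gromovProd_lt {o : X} {ξ ξ' : GromovBoundary X} {t : ℝ}
    (h : boundaryProd o ξ ξ' < (t : EReal)) :
    ∃ x x', ξ.Mem x ∧ ξ'.Mem x' ∧ ∃ᶠ i in atTop, gromovProd o (x i) (x' i) < t := by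
  simp only [boundaryProd, iInf_lt_iff] at h
  obtain ⟨x, hx, x', hx', h⟩ := h
  exact ⟨x, x', hx, hx',
    (frequently_lt_of_liminf_lt (by isBoundedDefault) h).mono fun _ => EReal.coe_lt_coe_iff.1⟩

/-- The points `y` lie on rays from `o` to the boundary points `ξ y`, up to a constant `E`. -/
def IsShadow (o : X) (E : ℝ) (ξ : X → GromovBoundary X) : Prop :=
  ∀ (y : X) (x : ℕ → X), (ξ y).Mem x → ∀ᶠ i in atTop, dist o y - E ≤ gromovProd o y (x i)

theorem IsVisualSpace.exists_isShadow (h : IsVisualSpace X) (o : X) :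
    ∃ (E : ℝ) (ξ : X → GromovBoundary X), 0 ≤ E ∧ IsShadow o E ξ := by
  obtain ⟨o', D, hD, h⟩ := h
  choose ξ hξ using h
  refine ⟨D + 1 + 2 * dist o o', ξ, by positivity, fun y x hx => ?_⟩
  have hlt : ((dist o' y - D - 1 : ℝ) : EReal) < pointBoundaryProd o' y (ξ y) :=
    (EReal.coe_lt_coe_iff.2 (sub_one_lt _)).trans_le (EReal.sub_le_of_le_add (hξ y))
  filter_upwards [eventually_lt_gromovProd_of_lt_pointBoundaryProd hlt hx] with i hi
  linarith [gromovProd_base o' o y (x i), dist_triangle o o' y, dist_comm o' o]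

namespace IsShadow

variable {o : X} {E δ : ℝ} {ξ : X → GromovBoundary X}

theorem le_gromovProd (h : IsShadow o E ξ) (hE : 0 ≤ E) (hδ0 : 0 ≤ δ)
    (hδ : ∀ o x y z : X, min (gromovProd o x y) (gromovProd o y z) - δ ≤ gromovProd o x z)
    {x y : X} {t : ℝ} (ht : (t : EReal) < boundaryProd o (ξ x) (ξ y)) (hx : t ≤ dist o x)
    (hy : t ≤ dist o y) : t - E - 2 * δ ≤ gromovProd o x y := by
  obtain ⟨u, hu⟩ := (ξ x).exists_mem
  obtain ⟨v, hv⟩ := (ξ y).exists_mem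
  obtain ⟨i, ⟨hxu, hyv⟩, huv⟩ := ((h x u hu).and (h y v hv)).and
    (eventually_lt_gromovProd_of_lt_boundaryProd ht hu hv) |>.exists
  rw [gromovProd_comm] at hyv
  exact gromovProd_chain hδ0 hδ (by linarith : t - E ≤ gromovProd o x (u i)) (by linarith)
    (by linarith)

theorem gromovProd_le (h : IsShadow o E ξ) (hE : 0 ≤ E) (hδ0 : 0 ≤ δ)
    (hδ : ∀ o x y z : X, min (gromovProd o x y) (gromovProd o y z) - δ ≤ gromovProd o x z)
    {x y : X} {t : ℝ} (ht : boundaryProd o (ξ x) (ξ y) < (t : EReal)) :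
    gromovProd o x y ≤ t + E + 2 * δ := by
  obtain ⟨u, v, hu, hv, hfreq⟩ := exists_frequently_gromovProd_lt ht
  obtain ⟨i, huv, hxu, hyv⟩ := (hfreq.and_eventually ((h x u hu).and (h y v hv))).exists
  rw [gromovProd_comm] at hxu
  have hx := gromovProd_le_left o x y
  have hy := gromovProd_le_right o x y
  have hchain := gromovProd_chain hδ0 hδ (by linarith : gromovProd o x y - E ≤ _)
    (by linarith : gromovProd o x y - E ≤ gromovProd o x y) (by linarith : _ ≤ gromovProd o y (v i))
  linarith

end IsShadow

end GromovProduct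

theorem powNeg_lt_iff {a v : ℝ} {t : EReal} (ha : 1 < a) (hv : 0 < v) (ht : 0 ≤ t) :
    powNeg a t < v ↔ ((-Real.logb a v : ℝ) : EReal) < t := by
  induction t with
  | bot => simp at ht
  | top => simp only [powNeg, if_true, hv, EReal.coe_lt_top]
  | coe b =>
    rw [powNeg, if_neg (EReal.coe_ne_top b), EReal.toReal_coe, EReal.coe_lt_coe_iff,
      ← Real.lt_logb_iff_rpow_lt ha hv, neg_lt]

namespace IsVisualMetric

variable {X : Type*} [MetricSpace X] [GromovHyperbolic X] [MetricSpace (GromovBoundary X)]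

theorem exists_dist_le (hvis : IsVisualMetric X) :
    ∃ Δ : ℝ, ∀ ξ ξ' : GromovBoundary X, dist ξ ξ' ≤ Δ := by
  obtain ⟨o, a, _, c₂, ha, -, hc₂, hd⟩ := hvis
  refine ⟨c₂ * 2, fun ξ ξ' => (hd ξ ξ').2.trans (mul_le_mul_of_nonneg_left ?_ hc₂.le)⟩
  have hprod := boundaryProd_nonneg o ξ ξ'
  refine ((powNeg_lt_iff ha two_pos hprod).2 (lt_of_lt_of_le ?_ hprod)).le
  exact_mod_cast neg_neg_of_pos (Real.logb_pos ha one_lt_two)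

theorem exists_log_comparison (hvis : IsVisualMetric X) {κ r : ℝ} (hκ : 0 < κ) (hr : 0 < r)
    (hr1 : r < 1) :
    ∃ (o : X) (h M : ℝ), 0 < h ∧ 0 ≤ M ∧ ∀ (ξ ξ' : GromovBoundary X) (N : ℕ),
      (dist ξ ξ' < κ * r ^ N → ((h * N - M : ℝ) : EReal) < boundaryProd o ξ ξ') ∧
        (κ * r ^ N ≤ dist ξ ξ' → boundaryProd o ξ ξ' < ((h * N + M : ℝ) : EReal)) := by
  obtain ⟨o, a, c₁, c₂, ha, hc₁, hc₂, hd⟩ := hvis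
  have hlog {c : ℝ} (hc : 0 < c) (N : ℕ) :
      -Real.logb a (κ * r ^ N / c) = -Real.logb a r * N - Real.logb a (κ / c) := by
    rw [mul_div_right_comm, Real.logb_mul (by positivity) (by positivity), Real.logb_pow]
    ring
  refine ⟨o, -Real.logb a r, |Real.logb a (κ / c₁)| + |Real.logb a (κ / c₂)| + 1,
    neg_pos.2 (Real.logb_neg ha hr hr1), by positivity,
    fun ξ ξ' N => ⟨fun hlt => ?_, fun hle => ?_⟩⟩
  · have hpow : powNeg a (boundaryProd o ξ ξ') < κ * r ^ N / c₁ :=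
      (lt_div_iff₀' hc₁).2 ((hd ξ ξ').1.trans_lt hlt)
    rw [powNeg_lt_iff ha (by positivity) (boundaryProd_nonneg o ξ ξ'), hlog hc₁] at hpow
    refine lt_of_le_of_lt (EReal.coe_le_coe_iff.2 ?_) hpow
    linarith [le_abs_self (Real.logb a (κ / c₁)), abs_nonneg (Real.logb a (κ / c₂))]
  · have hpow : ¬ powNeg a (boundaryProd o ξ ξ') < κ * r ^ N / c₂ :=
      not_lt.2 ((div_le_iff₀' hc₂).2 (hle.trans (hd ξ ξ').2))
    rw [powNeg_lt_iff ha (by positivity) (boundaryProd_nonneg o ξ ξ'), hlog hc₂, not_lt] at hpow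
    refine hpow.trans_lt (EReal.coe_lt_coe_iff.2 ?_)
    linarith [neg_abs_le (Real.logb a (κ / c₂)), abs_nonneg (Real.logb a (κ / c₁))]

theorem exists_cone_comparison (hvis : IsVisualMetric X) (hX : IsVisualSpace X) {κ r : ℝ}
    (hκ : 0 < κ) (hr : 0 < r) (hr1 : r < 1) :
    ∃ (ξ : X → GromovBoundary X) (m : X → ℕ) (h L : ℝ), 0 < h ∧ 0 ≤ L ∧ ∀ x y N,
      IsBranchLevel (fun i => κ * r ^ i) (ξ x) (ξ y) (m x) (m y) N →
        |dist x y - h * (m x + m y - 2 * N)| ≤ L := by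
  obtain ⟨o, h, M, hh, hM, hlog⟩ := hvis.exists_log_comparison hκ hr hr1
  obtain ⟨E, ξ, hE, hξ⟩ := hX.exists_isShadow o
  obtain ⟨δ, hδ0, hδ⟩ := GromovHyperbolic.exists_delta (X := X)
  let m (x : X) : ℕ := ⌊dist o x / h⌋₊
  have hm_le (x : X) : h * m x ≤ dist o x :=
    (le_div_iff₀' hh).1 (Nat.floor_le (by positivity))
  have hle_m (x : X) : dist o x ≤ h * (m x + 1) :=
    ((div_lt_iff₀' hh).1 (Nat.lt_floor_add_one _)).le
  refine ⟨ξ, m, h, 4 * h + 2 * M + 2 * E + 4 * δ, hh, by positivity, fun x y N hN => ?_⟩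
  have hlow : h * N - M - E - 2 * δ ≤ gromovProd o x y := by
    rcases hN.close with rfl | hlt
    · simp only [Nat.cast_zero, mul_zero]
      linarith [gromovProd_nonneg o x y]
    · have hNx : h * N ≤ h * m x := by gcongr; exact hN.le_left
      have hNy : h * N ≤ h * m y := by gcongr; exact hN.le_right
      exact hξ.le_gromovProd hE hδ0 (fun o x y z => (hδ o x y z).2.2) ((hlog _ _ N).1 hlt)
        (by linarith [hm_le x]) (by linarith [hm_le y])
  have hup : gromovProd o x y ≤ h * (N + 1) + M + E + 2 * δ := by
    rcases hN.far with rfl | rfl | hge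
    · linarith [gromovProd_le_left o x y, hle_m x]
    · linarith [gromovProd_le_right o x y, hle_m y]
    · have := hξ.gromovProd_le hE hδ0 (fun o x y z => (hδ o x y z).2.2) ((hlog _ _ (N + 1)).2 hge)
      push_cast at this
      linarith
  have hdist : dist x y = dist o x + dist o y - 2 * gromovProd o x y := by
    rw [gromovProd]
    ring
  rw [abs_le, hdist]
  constructor <;> linarith [hm_le x, hm_le y, hle_m x, hle_m y]

end IsVisualMetric

theorem IsQuasiIsometricEmbedding.of_comparison {X Y : Type*} [MetricSpace X] [MetricSpace Y]
    {f : X → Y} {T : X → X → ℝ} {h L A C : ℝ} (hh : 0 < h) (hL : 0 ≤ L) (hA : 0 < A) (hC : 0 < C)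
    (hT : ∀ x y, |dist x y - h * T x y| ≤ L)
    (hf : ∀ x y, A * T x y - C ≤ dist (f x) (f y) ∧ dist (f x) (f y) ≤ C * T x y + C) :
    IsQuasiIsometricEmbedding f := by
  refine ⟨A / h, C / h, (A + C) / h * L + C, by positivity, by positivity, by positivity,
    fun x y => ?_⟩
  obtain ⟨hlow, hup⟩ := abs_le.1 (hT x y)
  constructor
  · calc A / h * dist x y - ((A + C) / h * L + C)
        ≤ A / h * (h * T x y + L) - (A / h * L + C) := by
          have : A / h * L ≤ (A + C) / h * L := by gcongr; linarith
          gcongr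
          linarith
      _ = A * T x y - C := by field_simp; ring
      _ ≤ dist (f x) (f y) := (hf x y).1
  · calc dist (f x) (f y) ≤ C * T x y + C := (hf x y).2
      _ = C / h * (h * T x y - L) + (C / h * L + C) := by field_simp; ring
      _ ≤ C / h * dist x y + ((A + C) / h * L + C) := by
          gcongr <;> linarith

theorem theorem1p2 {X : Type*} [MetricSpace X] [GromovHyperbolic X]
    (hX : IsVisualSpace X)
    [MetricSpace (GromovBoundary X)] (hvis : IsVisualMetric X)
    (hdoub : IsDoublingSpace (GromovBoundary X)) :
    ∃ n : ℕ, capacityDim (GromovBoundary X) = (n : ℕ∞) ∧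
      ∃ f : X → (Fin (n + 1) → BinaryMetricTree), IsQuasiIsometricEmbedding f := by
  obtain ⟨n, hn, hcap⟩ := exists_capacityDim_eq hdoub.exists_capacityDimProperty
  obtain ⟨Δ, hΔ⟩ := hvis.exists_dist_le
  obtain ⟨κ, r, A, C, F, hκ, hr, hr1, hA, hC, hF⟩ := exists_cone_embedding hdoub hcap hΔ
  obtain ⟨ξ, m, h, L, hh, hL, hcone⟩ := hvis.exists_cone_comparison hX hκ hr hr1
  choose N hN using fun x y =>
    exists_isBranchLevel (fun i => κ * r ^ i) (ξ x) (ξ y) (m x) (m y)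
  exact ⟨n, hn, fun x => F (ξ x) (m x), .of_comparison hh hL hA hC
    (fun x y => hcone x y _ (hN x y)) fun x y => hF _ _ _ _ _ (hN x y)⟩
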